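/- Let $R$ be a commutative ring. A DG $R$-algebra is a non-negatively graded $R$-algebra $A=\bigoplus_{n\ge 0}A_n$ with $ab=(-1)^{|a||b|}ba$ for homogeneous $a,b$ and $a^2=0$ for $|a|$ odd, together with an $R$-linear differential of degree $-1$ satisfying $d(ab)=d(a)b+(-1)^{|a|}a\,d(b)$. DG modules are $\mathbb Z$-graded right DG modules with $\partial(ma)=\partial(m)a+(-1)^{|m|}m\,d(a)$; they are left modules via $am=(-1)^{|a||m|}ma$. Let $A\to B$ be a homomorphism of DG $R$-algebras such that $B$ is projective as a graded $A$-module, let $B^e=B\otimes_A B$ be the enveloping DG algebra, and let $J$ be the kernel of the multiplication map $B^e\to B$. Let $N$ be a semifree DG $B$-module, i.e. $N$ has, as a graded $B$-module, a homogeneous basis $\{e_\lambda\}$ indexed by a well-ordered set with $\partial^N(e_\lambda)\in\sum_{\mu<\lambda}e_\mu B$. For a DG $B^e$-module $X$ write $bx=(b\otimes 1)x$ and $xb=x(1\otimes b)$ for $b\in B$, $x\in X$. For $n\in\mathbb Z$ let $\mathrm{Der}_A(B,X)_n$ be the group of right $A$-linear maps $D:B\to X$ of degree $n$ with $D(b_1b_2)=D(b_1)b_2+(-1)^{n|b_1|}b_1D(b_2)$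 for homogeneous $b_1,b_2\in B$. A $D$-connection on $N$ along $X$ is a right $A$-linear map $\psi:N\to N\otimes_BX$ of degree $n$ with $\psi(xb)=\psi(x)b+(-1)^{n|x|}x\otimes_B D(b)$ for $b\in B$ and homogeneous $x\in N$. Let ${}^*\mathrm{Der}_A(B,X)=\bigoplus_n\mathrm{Der}_A(B,X)_n$, let ${}^*\mathrm{Conn}(N,N\otimes_BX)$ be the direct sum over $n$ of the groups of $D$-connections with $D\in\mathrm{Der}_A(B,X)_n$ (if $N=0$, the zero maps regarded as $D$-connections for different $D$ are distinguished), and let ${}^*\mathrm{Hom}_B(N,N\otimes_BX)$ be the direct sum over $n$ of the groups of right $B$-linear maps $N\to N\otimes_BX$ of degree $n$. These are left DG $B$-modules with $(bg)(y)=b\,g(y)$, where $b(x\otimes y)=(bx)\otimes y$ on $N\otimes_B X$, and with differentials $\partial^{\mathrm{Der}}(D)=\partial^X\circ D-(-1)^{|D|}D\circ d^B$, and $\partial(\psi)=\partial^{N\otimes_B X}\circ\psi-(-1)^{|\psi|}\psi\circ\partial^N$ on the other two; the latter is denoted $\partial^{\mathrm{Conn}}$ on ${}^*\mathrm{Conn}(N,N\otimes_BX)$.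 The fundamental exact sequence $\mathcal E_N(X)$ is $$0\to{}^*\mathrm{Hom}_B(N,N\otimes_BX)\xrightarrow{\ \iota\ }{}^*\mathrm{Conn}(N,N\otimes_BX)\xrightarrow{\ \nu\ }{}^*\mathrm{Der}_A(B,X)\to0,$$ where $\iota$ regards a $B$-linear map as a $0$-connection and $\nu$ sends a $D$-connection to $D$. A ${}^*\mathrm{Der}_A(B,X)$-connection on $N$ is a homomorphism of left DG $B$-modules $\nabla:{}^*\mathrm{Der}_A(B,X)\to{}^*\mathrm{Conn}(N,N\otimes_BX)$ such that $\nabla_D$ is a $D$-connection for every homogeneous $D$. Let $\delta:B\to J$, $\delta(b)=b\otimes1-1\otimes b$, be the universal derivation. Finally, $N$ is naïvely liftable to $A$ if the homomorphism $\pi_N:N\otimes_AB\to N$, $n\otimes b\mapsto nb$, has a right inverse in the category of DG $B$-modules. **Theorem.** The following are equivalent: (i) $N$ is naïvely liftable to $A$; (ii) there is a $\delta$-connection $\psi\in{}^*\mathrm{Conn}(N,N\otimes_BJ)$ with $\partial^{\mathrm{Conn}}(\psi)=0$; (iii) $\mathcal E_N(J)$ splits as a sequence of left DG $B$-modules; (iv)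 $\mathcal E_N(X)$ splits as a sequence of left DG $B$-modules for every DG $B^e$-module $X$; (v) $N$ admits a ${}^*\mathrm{Der}_A(B,J)$-connection; (vi) $N$ admits a ${}^*\mathrm{Der}_A(B,X)$-connection for every DG $B^e$-module $X$. -/

import Mathlib

universe u

namespace NaiveLifting

noncomputable section

open scoped TensorProduct RightActions

/-! ### Signs and internally graded abelian groups -/

/-- The sign `(-1) ^ n` for an integer `n`. -/
def sgn (n : ℤ) : ℤ := (n.negOnePow : ℤ)

lemma sgn_add (m n : ℤ) : sgn (m + n) = sgn m * sgn n := by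
  simp [sgn, Int.negOnePow_add]

@[simp] lemma sgn_zero : sgn 0 = 1 := by simp [sgn]

lemma sgn_congr {m n : ℤ} (h : Even (m - n)) : sgn m = sgn n := by
  unfold sgn
  rw [(Int.negOnePow_eq_iff m n).2 h]

lemma sgn_odd {n : ℤ} (h : Odd n) : sgn n = -1 := by
  simp [sgn, Int.negOnePow_odd n h]

section Graded

variable {M P σ : Type*} [AddCommGroup M] [AddCommGroup P] [SetLike σ M] [AddSubgroupClass σ M]
  {G : ℤ → σ}

/-- The additive map on a graded group with prescribed values on the homogeneous components. -/
def gLift (h : DirectSum.IsInternal G) (f : ∀ i, G i →+ P) : M →+ P :=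
  (DirectSum.toAddMonoid f).comp
    (AddEquiv.ofBijective (DirectSum.coeAddMonoidHom G) h).symm.toAddMonoidHom

lemma gLift_apply (h : DirectSum.IsInternal G) (f : ∀ i, G i →+ P) {i : ℤ} {m : M} (hm : m ∈ G i) :
    gLift h f m = f i ⟨m, hm⟩ := by
  have : (AddEquiv.ofBijective (DirectSum.coeAddMonoidHom G) h).symm m
      = DirectSum.of (fun i => G i) i ⟨m, hm⟩ := by
    rw [AddEquiv.symm_apply_eq]
    exact (DirectSum.coeAddMonoidHom_of G i ⟨m, hm⟩).symm
  simp [gLift, this]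

lemma homog_induction (h : DirectSum.IsInternal G) {p : M → Prop} (zero : p 0)
    (add : ∀ x y, p x → p y → p (x + y)) (homog : ∀ i, ∀ m ∈ G i, p m) (m : M) : p m := by
  obtain ⟨x, rfl⟩ := h.2 m
  induction x using DirectSum.induction_on with
  | zero => simpa using zero
  | of i x => simpa using homog i x x.2
  | add x y hx hy => simpa using add _ _ hx hy

lemma homog_ext (h : DirectSum.IsInternal G) {f g : M →+ P} (H : ∀ i, ∀ m ∈ G i, f m = g m) :
    f = g := by
  ext m
  refine homog_induction h (p := fun m => f m = g m) (by simp) ?_ H m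
  intro x y hx hy
  simp [hx, hy]

/-- The projection of a graded group onto its component of degree `n`. -/
def gProj (h : DirectSum.IsInternal G) (n : ℤ) : M →+ M :=
  gLift h fun i => if i = n then AddSubmonoidClass.subtype (G i) else 0

lemma gProj_apply (h : DirectSum.IsInternal G) (n : ℤ) {i : ℤ} {m : M} (hm : m ∈ G i) :
    gProj h n m = if i = n then m else 0 := by
  rw [gProj, gLift_apply h _ hm]
  split_ifs <;> simp

lemma gProj_mem (h : DirectSum.IsInternal G) (n : ℤ) (m : M) : gProj h n m ∈ G n := by
  refine homog_induction h (p := fun m => gProj h n m ∈ G n) ?_ ?_ ?_ m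
  · simp [zero_mem]
  · intro x y hx hy
    simpa using add_mem hx hy
  · intro i m hm
    rw [gProj_apply h n hm]
    split_ifs with hi
    · exact hi ▸ hm
    · exact zero_mem _

/-- A family of subgroups is a grading as soon as it generates and admits projections. -/
lemma isInternal_of_proj (q : ℤ → M →+ M)
    (hq : ∀ n i, ∀ m ∈ G i, q n m = if i = n then m else 0)
    (hgen : ∀ p : M → Prop, p 0 → (∀ x y, p x → p y → p (x + y)) →
      (∀ i, ∀ m ∈ G i, p m) → ∀ m, p m) :
    DirectSum.IsInternal G := by
  have key : ∀ (n : ℤ) (x : DirectSum ℤ fun i => G i),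
      q n (DirectSum.coeAddMonoidHom G x) = x n := by
    intro n x
    induction x using DirectSum.induction_on with
    | zero => simp
    | of i x =>
      rw [DirectSum.coeAddMonoidHom_of, hq n i x x.2]
      split_ifs with h
      · subst h; simp
      · rw [DirectSum.of_eq_of_ne _ _ _ (Ne.symm h)]; simp
    | add x y hx hy => simp [hx, hy]
  constructor
  · rw [injective_iff_map_eq_zero]
    intro x hx
    ext n
    rw [← key n x, hx]
    simp
  · refine hgen _ ⟨0, by simp⟩ ?_ ?_
    · rintro _ _ ⟨x, rfl⟩ ⟨y, rfl⟩
      exact ⟨x + y, by simp⟩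
    · intro i m hm
      exact ⟨DirectSum.of (fun i => G i) i ⟨m, hm⟩, by simp⟩

end Graded

/-! ### DG algebras and right DG modules -/

/-- A (strongly graded-commutative, non-negatively graded) DG `R`-algebra. -/
structure DGAlg (R : Type u) [CommRing R] where
  carrier : Type u
  [ring : Ring carrier]
  [algebra : Algebra R carrier]
  gr : ℤ → Submodule R carrier
  [gradedAlgebra : GradedAlgebra gr]
  gr_neg : ∀ i < 0, gr i = ⊥
  gcomm : ∀ i j, ∀ a ∈ gr i, ∀ b ∈ gr j, a * b = sgn (i * j) • (b * a)
  odd_sq : ∀ i, Odd i → ∀ a ∈ gr i, a * a = 0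
  d : carrier →ₗ[R] carrier
  d_mem : ∀ i, ∀ a ∈ gr i, d a ∈ gr (i - 1)
  d_d : ∀ a, d (d a) = 0
  leibniz : ∀ i, ∀ a ∈ gr i, ∀ b, d (a * b) = d a * b + sgn i • (a * d b)

attribute [instance] DGAlg.ring DGAlg.algebra DGAlg.gradedAlgebra

variable {R : Type u} [CommRing R]

instance : CoeSort (DGAlg R) (Type u) := ⟨DGAlg.carrier⟩

lemma DGAlg.isInternal (A : DGAlg R) : DirectSum.IsInternal A.gr :=
  DirectSum.Decomposition.isInternal A.gr

lemma DGAlg.one_mem (A : DGAlg R) : (1 : A) ∈ A.gr 0 := SetLike.GradedOne.one_mem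

lemma DGAlg.mul_mem (A : DGAlg R) {i j : ℤ} {a b : A} (ha : a ∈ A.gr i) (hb : b ∈ A.gr j) :
    a * b ∈ A.gr (i + j) := SetLike.GradedMul.mul_mem ha hb

lemma DGAlg.d_one (A : DGAlg R) : A.d 1 = 0 := by
  have := A.leibniz 0 1 A.one_mem 1
  simpa using this

/-- A homomorphism of DG `R`-algebras. -/
structure DGAlgHom (A B : DGAlg R) extends A.carrier →ₐ[R] B.carrier where
  map_mem : ∀ i, ∀ a ∈ A.gr i, toFun a ∈ B.gr i
  map_d : ∀ a, toFun (A.d a) = B.d (toFun a)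

instance (A B : DGAlg R) : CoeFun (DGAlgHom A B) (fun _ => A → B) := ⟨fun f => f.toAlgHom⟩

lemma DGAlgHom.mem {A B : DGAlg R} (f : DGAlgHom A B) {i : ℤ} {a : A} (h : a ∈ A.gr i) :
    f a ∈ B.gr i := f.map_mem i a h

lemma DGAlgHom.d {A B : DGAlg R} (f : DGAlgHom A B) (a : A) : f (A.d a) = B.d (f a) := f.map_d a

/-- A `ℤ`-graded right module over the underlying graded algebra of `A`. The element
`x <• a` is the product `x a`. -/
structure GrMod (A : DGAlg R) where
  carrier : Type u
  [grp : AddCommGroup carrier]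
  [mod : Module A.carrierᵐᵒᵖ carrier]
  gr : ℤ → AddSubgroup carrier
  isInternal : DirectSum.IsInternal gr
  smul_mem : ∀ i j, ∀ x ∈ gr i, ∀ a ∈ A.gr j, x <• a ∈ gr (i + j)

attribute [instance] GrMod.grp GrMod.mod

instance (A : DGAlg R) : CoeSort (GrMod A) (Type u) := ⟨GrMod.carrier⟩

/-- A degree-preserving homomorphism of graded right modules. -/
structure GrHom {A : DGAlg R} (M N : GrMod A) extends M.carrier →ₗ[A.carrierᵐᵒᵖ] N.carrier where
  map_mem : ∀ i, ∀ x ∈ M.gr i, toFun x ∈ N.gr i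

instance {A : DGAlg R} (M N : GrMod A) : CoeFun (GrHom M N) (fun _ => M → N) :=
  ⟨fun f => f.toLinearMap⟩

/-- Projectivity in the abelian category of graded right modules. -/
def GrMod.IsProjective {A : DGAlg R} (P : GrMod A) : Prop :=
  ∀ (M N : GrMod A) (p : GrHom M N) (f : GrHom P N), Function.Surjective p →
    ∃ g : GrHom P M, ∀ x, p (g x) = f x

/-- A right DG module over `A`. -/
structure DGMod (A : DGAlg R) extends GrMod A where
  d : carrier →+ carrier
  d_mem : ∀ i, ∀ x ∈ gr i, d x ∈ gr (i - 1)
  d_d : ∀ x, d (d x) = 0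
  leibniz : ∀ i, ∀ x ∈ gr i, ∀ a : A, d (x <• a) = d x <• a + sgn i • (x <• A.d a)

instance (A : DGAlg R) : CoeSort (DGMod A) (Type u) := ⟨fun M => M.toGrMod.carrier⟩

/-- A homomorphism of right DG modules. -/
structure DGHom {A : DGAlg R} (M N : DGMod A) extends GrHom M.toGrMod N.toGrMod where
  map_d : ∀ x, toFun (M.d x) = N.d (toFun x)

instance {A : DGAlg R} (M N : DGMod A) : CoeFun (DGHom M N) (fun _ => M → N) :=
  ⟨fun f => f.toLinearMap⟩

/-- `N` is semifree: its underlying graded module has a homogeneous basis, indexed by a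
well-ordered set, such that the differential of each basis element is a combination of strictly
smaller basis elements. -/
def DGMod.IsSemifree {B : DGAlg R} (N : DGMod B) : Prop :=
  ∃ (L : Type u) (_ : LinearOrder L) (_ : WellFoundedLT L)
    (e : Module.Basis L B.carrierᵐᵒᵖ N.carrier),
    (∀ l, ∃ n, e l ∈ N.gr n) ∧
    ∀ l, N.d (e l) ∈ Submodule.span B.carrierᵐᵒᵖ (e '' Set.Iio l)

section Sign

variable {A : DGAlg R} (X : GrMod A)

lemma GrMod.smul_mem' {i j : ℤ} {x : X} {a : A} (hx : x ∈ X.gr i) (ha : a ∈ A.gr j) :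
    x <• a ∈ X.gr (i + j) := X.smul_mem i j x hx a ha

/-- Right multiplication as a biadditive map. -/
def GrMod.rmul : A →+ X →+ X :=
  AddMonoidHom.mk' (fun a => DistribSMul.toAddMonoidHom X (MulOpposite.op a)) (by
    intro a b
    ext x
    simp [add_smul])

@[simp] lemma GrMod.rmul_apply (a : A) (x : X) : X.rmul a x = x <• a := rfl

/-- The additive endomorphism `x ↦ (-1) ^ (i |x|) x`. -/
def GrMod.twist (i : ℤ) : X →+ X :=
  gLift X.isInternal fun j => sgn (i * j) • (X.gr j).subtype

lemma GrMod.twist_apply (i : ℤ) {j : ℤ} {x : X} (hx : x ∈ X.gr j) :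
    X.twist i x = sgn (i * j) • x := by
  rw [GrMod.twist, gLift_apply X.isInternal _ hx]
  simp

/-- The left module structure attached to a right module over the graded-commutative
algebra `A`: on homogeneous elements, `a x = (-1) ^ (|a| |x|) x a`. -/
def GrMod.lsmul : A →+ X →+ X :=
  gLift A.isInternal fun i =>
    AddMonoidHom.mk' (fun a => (X.rmul (a : A)).comp (X.twist i)) (by
      intro a b
      ext x
      simp)

lemma GrMod.lsmul_apply {i j : ℤ} {a : A} {x : X} (ha : a ∈ A.gr i) (hx : x ∈ X.gr j) :
    X.lsmul a x = sgn (i * j) • (x <• a) := by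
  rw [GrMod.lsmul, gLift_apply A.isInternal _ ha]
  simp only [AddMonoidHom.mk'_apply, AddMonoidHom.comp_apply, GrMod.rmul_apply]
  rw [X.twist_apply i hx, smul_comm]

lemma GrMod.lsmul_mem {i j : ℤ} {a : A} {x : X} (ha : a ∈ A.gr i) (hx : x ∈ X.gr j) :
    X.lsmul a x ∈ X.gr (i + j) := by
  rw [X.lsmul_apply ha hx, add_comm i j]
  exact zsmul_mem (X.smul_mem' hx ha) _

/-- Induction for identities that are additive in an element of a graded module. -/
lemma GrMod.ext_homog {P : Type*} [AddCommGroup P] {f g : X →+ P}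
    (H : ∀ i, ∀ x ∈ X.gr i, f x = g x) (x : X) : f x = g x :=
  DFunLike.congr_fun (homog_ext X.isInternal H) x

lemma DGAlg.ext_homog {P : Type*} [AddCommGroup P] {f g : A →+ P}
    (H : ∀ i, ∀ a ∈ A.gr i, f a = g a) (a : A) : f a = g a :=
  DFunLike.congr_fun (homog_ext A.isInternal H) a

lemma GrMod.lsmul_one (x : X) : X.lsmul 1 x = x := by
  refine X.ext_homog (f := X.lsmul 1) (g := AddMonoidHom.id _) ?_ x
  intro i x hx
  simp [X.lsmul_apply A.one_mem hx]

lemma GrMod.lsmul_rsmul (a : A) (x : X) (c : A) : X.lsmul a (x <• c) = (X.lsmul a x) <• c := by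
  refine A.ext_homog (f := (X.lsmul.flip (x <• c))) (g := (X.rmul c).comp (X.lsmul.flip x)) ?_ a
  intro i a ha
  refine X.ext_homog (f := (X.lsmul a).comp (X.rmul c)) (g := (X.rmul c).comp (X.lsmul a)) ?_ x
  intro j x hx
  refine A.ext_homog (f := (X.lsmul a).comp (X.rmul.flip x)) (g := X.rmul.flip (X.lsmul a x)) ?_ c
  intro k c hc
  simp only [AddMonoidHom.comp_apply, AddMonoidHom.flip_apply, GrMod.rmul_apply]
  rw [X.lsmul_apply ha hx, X.lsmul_apply ha (X.smul_mem' hx hc), smul_comm _ (sgn _),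
    op_smul_op_smul, op_smul_op_smul, A.gcomm _ _ a ha c hc, MulOpposite.op_smul, smul_assoc,
    smul_smul, mul_add, sgn_add]

lemma GrMod.lsmul_mul (a b : A) (x : X) : X.lsmul (a * b) x = X.lsmul a (X.lsmul b x) := by
  refine A.ext_homog (f := (X.lsmul.flip x).comp (AddMonoidHom.mulRight b))
    (g := X.lsmul.flip (X.lsmul b x)) ?_ a
  intro i a ha
  refine A.ext_homog (f := (X.lsmul.flip x).comp (AddMonoidHom.mulLeft a))
    (g := (X.lsmul a).comp (X.lsmul.flip x)) ?_ b
  intro j b hb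
  refine X.ext_homog (f := X.lsmul (a * b)) (g := (X.lsmul a).comp (X.lsmul b)) ?_ x
  intro k x hx
  simp only [AddMonoidHom.comp_apply]
  rw [X.lsmul_apply (A.mul_mem ha hb) hx, X.lsmul_apply ha (X.lsmul_mem hb hx),
    X.lsmul_apply hb hx, A.gcomm _ _ a ha b hb, smul_comm _ (sgn _), op_smul_op_smul,
    MulOpposite.op_smul, smul_assoc, smul_smul, smul_smul, ← sgn_add, ← sgn_add]
  congr 1
  exact sgn_congr ⟨0, by ring⟩

lemma DGMod.d_lsmul (X : DGMod A) {i : ℤ} {a : A} (ha : a ∈ A.gr i) (x : X) :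
    X.d (X.lsmul a x) = X.lsmul (A.d a) x + sgn i • X.lsmul a (X.d x) := by
  refine X.ext_homog (f := X.d.comp (X.lsmul a))
    (g := X.lsmul (A.d a) + sgn i • (X.lsmul a).comp X.d) ?_ x
  intro j x hx
  simp only [AddMonoidHom.comp_apply, AddMonoidHom.add_apply, AddMonoidHom.smul_apply]
  rw [X.lsmul_apply ha hx, X.lsmul_apply (A.d_mem _ _ ha) hx,
    X.lsmul_apply ha (X.d_mem _ _ hx), map_zsmul, X.leibniz j x hx, smul_add, smul_smul, smul_smul,
    ← sgn_add, ← sgn_add, add_comm]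
  congr 2
  · exact sgn_congr ⟨j, by ring⟩
  · exact sgn_congr ⟨0, by ring⟩

end Sign

/-! ### The regular module, restriction of scalars, kernels -/

section Basic

variable {A C : DGAlg R}

/-- `C` as a right DG module over itself. -/
def DGMod.self (C : DGAlg R) : DGMod C where
  carrier := C
  gr i := (C.gr i).toAddSubgroup
  isInternal := C.isInternal
  smul_mem _ _ _ hx _ ha := C.mul_mem hx ha
  d := C.d.toAddMonoidHom
  d_mem := C.d_mem
  d_d := C.d_d
  leibniz := C.leibniz

/-- Restriction of scalars of a right DG module along a homomorphism of DG algebras. -/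
def DGMod.restrict (f : DGAlgHom A C) (X : DGMod C) : DGMod A where
  carrier := X
  mod := Module.compHom X (RingHom.op f.toAlgHom.toRingHom)
  gr := X.gr
  isInternal := X.isInternal
  smul_mem i j x hx a ha := X.smul_mem i j x hx (f a) (f.mem ha)
  d := X.d
  d_mem := X.d_mem
  d_d := X.d_d
  leibniz i x hx a := by
    have h := X.leibniz i x hx (f a)
    rw [← f.d] at h
    exact h

lemma DGMod.restrict_lsmul (f : DGAlgHom A C) (X : DGMod C) (a : A) (x : X) :
    (DGMod.restrict f X).lsmul a x = X.lsmul (f a) x := by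
  refine A.ext_homog (f := ((DGMod.restrict f X).lsmul.flip x))
    (g := (X.lsmul.flip x).comp (f.toAlgHom : A →+ C)) ?_ a
  intro i a ha
  refine X.ext_homog (f := (DGMod.restrict f X).lsmul a) (g := X.lsmul (f a)) ?_ x
  intro j x hx
  refine Eq.trans ?_ (X.lsmul_apply (f.mem ha) hx).symm
  exact (DGMod.restrict f X).lsmul_apply ha hx

lemma DGMod.self_lsmul (C : DGAlg R) (a x : C) : (DGMod.self C).lsmul a x = a * x := by
  refine C.ext_homog (f := (DGMod.self C).lsmul.flip x) (g := AddMonoidHom.mulRight x) ?_ a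
  intro i a ha
  refine C.ext_homog (f := (DGMod.self C).lsmul a) (g := AddMonoidHom.mulLeft a) ?_ x
  intro j x hx
  refine ((DGMod.self C).lsmul_apply ha hx).trans ?_
  exact (C.gcomm _ _ a ha x hx).symm

/-- The kernel of a homomorphism of right DG modules. -/
def DGHom.ker {M N : DGMod C} (f : DGHom M N) : DGMod C where
  carrier := LinearMap.ker f.toLinearMap
  gr i := (M.gr i).comap (LinearMap.ker f.toLinearMap).subtype.toAddMonoidHom
  isInternal := by
    have hq : ∀ n (x : M), f (gProj M.isInternal n x) = gProj N.isInternal n (f x) := by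
      intro n x
      refine M.ext_homog (f := f.toLinearMap.toAddMonoidHom.comp (gProj M.isInternal n))
        (g := (gProj N.isInternal n).comp f.toLinearMap.toAddMonoidHom) ?_ x
      intro i x hx
      have h1 := gProj_apply M.isInternal n hx
      have h2 := gProj_apply N.isInternal n (f.map_mem i x hx)
      change f (gProj M.isInternal n x) = gProj N.isInternal n (f x)
      refine Eq.trans ?_ h2.symm
      rw [h1]
      split_ifs
      · rfl
      · exact map_zero f.toLinearMap
    let q : ℤ → LinearMap.ker f.toLinearMap →+ LinearMap.ker f.toLinearMap := fun n =>
      AddMonoidHom.mk' (fun x => ⟨gProj M.isInternal n x, by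
        have := hq n x
        rw [LinearMap.mem_ker]
        refine this.trans ?_
        rw [LinearMap.mem_ker.1 x.2, map_zero]⟩) (by
        intro x y
        ext
        simp)
    refine isInternal_of_proj q ?_ ?_
    · intro n i x hx
      ext
      have h1 := gProj_apply M.isInternal n (m := (x : M)) hx
      refine h1.trans ?_
      split_ifs <;> rfl
    · intro p h0 hadd hh x
      have hsum : ∀ x : M, ∃ s : Finset ℤ, x = ∑ n ∈ s, gProj M.isInternal n x := by
        classical
        intro x
        obtain ⟨y, rfl⟩ := M.isInternal.2 x
        refine ⟨y.support, ?_⟩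
        have key : ∀ n, gProj M.isInternal n (DirectSum.coeAddMonoidHom M.gr y) = y n := by
          intro n
          induction y using DirectSum.induction_on with
          | zero => simp
          | of i x =>
            rw [DirectSum.coeAddMonoidHom_of, gProj_apply M.isInternal n x.2]
            split_ifs with h
            · subst h; simp
            · rw [DirectSum.of_eq_of_ne _ _ _ (Ne.symm h)]; simp
          | add x y hx hy => simp [hx, hy]
        simp only [key]
        conv_lhs => rw [← DirectSum.sum_support_of y]
        simp
      obtain ⟨s, hs⟩ := hsum x
      have hx : x = ∑ n ∈ s, q n x := by
        ext
        rw [AddSubmonoidClass.coe_finsetSum]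
        exact hs
      rw [hx]
      refine Finset.sum_induction _ p (fun a b => hadd a b) h0 ?_
      intro n _
      exact hh n _ (gProj_mem M.isInternal n x)
  smul_mem i j x hx a ha := M.smul_mem i j x hx a ha
  d := AddMonoidHom.mk' (fun x => ⟨M.d x, by
      rw [LinearMap.mem_ker]
      refine (f.map_d x).trans ?_
      have := LinearMap.mem_ker.1 x.2
      exact (congrArg N.d this).trans (map_zero _)⟩) (by
    intro x y
    ext
    simp)
  d_mem i x hx := M.d_mem i x hx
  d_d x := Subtype.ext (M.d_d x)
  leibniz i x hx a := Subtype.ext (M.leibniz i x hx a)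

end Basic

/-! ### Tensor products -/

section Tensor

variable {A C : DGAlg R} (f : DGAlgHom A C) (N : DGMod A) (X : DGMod C)

/-- The subgroup of `N ⊗ X` (tensor product of abelian groups) generated by all
`n a ⊗ x - n ⊗ a x`. -/
def tensorRel : AddSubgroup (N ⊗[ℤ] X) :=
  AddSubgroup.closure {t | ∃ (n : N) (a : A) (x : X),
    t = (n <• a) ⊗ₜ[ℤ] x - n ⊗ₜ[ℤ] (X.lsmul (f a) x)}

/-- The underlying abelian group of `N ⊗_A X`, where the right module `X` over `C` is a left
module over `A` by the sign rule and restriction along `f : A → C`. -/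
def TensorCarrier : Type u := (N ⊗[ℤ] X) ⧸ tensorRel f N X

instance : AddCommGroup (TensorCarrier f N X) :=
  inferInstanceAs (AddCommGroup ((N ⊗[ℤ] X) ⧸ tensorRel f N X))

/-- The pure tensor `n ⊗ x`, as a biadditive map. -/
def tmul : N →+ X →+ TensorCarrier f N X :=
  AddMonoidHom.mk' (fun n => AddMonoidHom.mk' (fun x => QuotientAddGroup.mk (n ⊗ₜ[ℤ] x))
      (by intro x y; rw [TensorProduct.tmul_add]; rfl))
    (by intro m n; ext x
        exact congrArg QuotientAddGroup.mk (TensorProduct.add_tmul m n x))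

lemma tmul_smul (n : N) (a : A) (x : X) :
    tmul f N X (n <• a) x = tmul f N X n (X.lsmul (f a) x) := by
  refine QuotientAddGroup.eq_iff_sub_mem.2 ?_
  exact AddSubgroup.subset_closure ⟨n, a, x, rfl⟩

variable {N X}

/-- The additive map on `N ⊗_A X` induced by a balanced biadditive map. -/
def tlift {P : Type*} [AddCommGroup P] (β : N →+ X →+ P)
    (h : ∀ i, ∀ n ∈ N.gr i, ∀ j, ∀ a ∈ A.gr j, ∀ k, ∀ x ∈ X.gr k,
      β (n <• a) x = β n (X.lsmul (f a) x)) : TensorCarrier f N X →+ P :=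
  QuotientAddGroup.lift (tensorRel f N X)
    (TensorProduct.liftAddHom β (by intro r m n; simp)) (by
      rw [tensorRel, AddSubgroup.closure_le]
      rintro _ ⟨n, a, x, rfl⟩
      have h' : β (n <• a) x = β n (X.lsmul (f a) x) := by
        refine N.ext_homog (f := (β.flip x).comp (N.rmul a))
          (g := β.flip (X.lsmul (f a) x)) ?_ n
        intro i n hn
        refine A.ext_homog (f := (β.flip x).comp (N.rmul.flip n))
          (g := (β n).comp ((X.lsmul.flip x).comp (f.toAlgHom : A →+ C))) ?_ a
        intro j a ha
        refine X.ext_homog (f := β (n <• a)) (g := (β n).comp (X.lsmul (f a))) ?_ x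
        intro k x hx
        exact h i n hn j a ha k x hx
      simp [h'])

@[simp] lemma tlift_tmul {P : Type*} [AddCommGroup P] (β : N →+ X →+ P) (h) (n : N) (x : X) :
    tlift f β h (tmul f N X n x) = β n x := rfl

lemma tensor_induction {p : TensorCarrier f N X → Prop} (zero : p 0)
    (add : ∀ s t, p s → p t → p (s + t))
    (homog : ∀ i, ∀ n ∈ N.gr i, ∀ j, ∀ x ∈ X.gr j, p (tmul f N X n x)) (t) : p t := by
  obtain ⟨t, rfl⟩ := QuotientAddGroup.mk_surjective t
  induction t using TensorProduct.induction_on with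
  | zero => exact zero
  | add s t hs ht => exact add _ _ hs ht
  | tmul n x =>
    change p (tmul f N X n x)
    refine homog_induction N.isInternal (p := fun n => p (tmul f N X n x)) (by simpa) ?_ ?_ n
    · intro m n hm hn
      simpa using add _ _ hm hn
    intro i n hn
    refine homog_induction X.isInternal (p := fun x => p (tmul f N X n x)) (by simpa) ?_ ?_ x
    · intro m n hm hn
      simpa using add _ _ hm hn
    exact homog i n hn

lemma tensor_ext {P : Type*} [AddCommGroup P] {g h : TensorCarrier f N X →+ P}
    (H : ∀ i, ∀ n ∈ N.gr i, ∀ j, ∀ x ∈ X.gr j, g (tmul f N X n x) = h (tmul f N X n x))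
    (t : TensorCarrier f N X) : g t = h t :=
  tensor_induction f (p := fun t => g t = h t) (by simp)
    (by intro s t hs ht; simp [hs, ht]) H t

variable (N X)

/-- Right multiplication on `N ⊗_A X` by an element of `C`. -/
def tensorSMul (c : C) : TensorCarrier f N X →+ TensorCarrier f N X :=
  tlift f ((tmul f N X).compl₂ (X.rmul c)) (by
    intro i n _ j a _ k x _
    simp only [AddMonoidHom.compl₂_apply, GrMod.rmul_apply]
    rw [tmul_smul, X.lsmul_rsmul])

lemma tensorSMul_tmul (c : C) (n : N) (x : X) :
    tensorSMul f N X c (tmul f N X n x) = tmul f N X n (x <• c) := rfl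

instance : Module C.carrierᵐᵒᵖ (TensorCarrier f N X) where
  smul c t := tensorSMul f N X c.unop t
  one_smul t := by
    change tensorSMul f N X 1 t = AddMonoidHom.id _ t
    refine tensor_ext f ?_ t
    intro i n _ j x _
    simp [tensorSMul_tmul]
  mul_smul a b t := by
    change tensorSMul f N X (b.unop * a.unop) t
      = ((tensorSMul f N X a.unop).comp (tensorSMul f N X b.unop)) t
    refine tensor_ext f ?_ t
    intro i n _ j x _
    simp [tensorSMul_tmul, mul_smul]
  smul_zero a := map_zero _
  smul_add a := map_add _
  add_smul a b t := by
    change tensorSMul f N X (a.unop + b.unop) t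
      = (tensorSMul f N X a.unop + tensorSMul f N X b.unop) t
    refine tensor_ext f ?_ t
    intro i n _ j x _
    simp [tensorSMul_tmul, add_smul]
  zero_smul t := by
    change tensorSMul f N X 0 t = (0 : TensorCarrier f N X →+ TensorCarrier f N X) t
    refine tensor_ext f ?_ t
    intro i n _ j x _
    simp [tensorSMul_tmul]

lemma tmul_rsmul (c : C) (n : N) (x : X) :
    (tmul f N X n x) <• c = tmul f N X n (x <• c) := rfl

/-- The component of degree `k` of `N ⊗_A X`. -/
def tensorGr (k : ℤ) : AddSubgroup (TensorCarrier f N X) :=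
  AddSubgroup.closure {t | ∃ i j, i + j = k ∧ ∃ n ∈ N.gr i, ∃ x ∈ X.gr j, t = tmul f N X n x}

variable {N X} in
lemma tmul_mem {i j k : ℤ} (h : i + j = k) {n : N} {x : X} (hn : n ∈ N.gr i) (hx : x ∈ X.gr j) :
    tmul f N X n x ∈ tensorGr f N X k :=
  AddSubgroup.subset_closure ⟨i, j, h, n, hn, x, hx, rfl⟩

/-- The projection of `N ⊗_A X` onto its component of degree `k`. -/
def tensorProj (k : ℤ) : TensorCarrier f N X →+ TensorCarrier f N X :=
  tlift f (gLift N.isInternal fun i => AddMonoidHom.mk'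
      (fun n => (tmul f N X n).comp (gProj X.isInternal (k - i)))
      (by intro m n; ext x; simp)) (by
    intro i n hn j a ha l x hx
    rw [gLift_apply N.isInternal _ hn, gLift_apply N.isInternal _ (N.smul_mem' hn ha)]
    simp only [AddMonoidHom.mk'_apply, AddMonoidHom.comp_apply]
    rw [gProj_apply X.isInternal _ hx, gProj_apply X.isInternal _ (X.lsmul_mem (f.mem ha) hx)]
    by_cases hk : l = k - (i + j)
    · rw [if_pos hk, if_pos (by omega), tmul_smul]
    · rw [if_neg hk, if_neg (by omega)]
      simp)

lemma tensorProj_tmul (k : ℤ) {i j : ℤ} {n : N} {x : X} (hn : n ∈ N.gr i) (hx : x ∈ X.gr j) :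
    tensorProj f N X k (tmul f N X n x) = if i + j = k then tmul f N X n x else 0 := by
  rw [tensorProj, tlift_tmul, gLift_apply N.isInternal _ hn]
  simp only [AddMonoidHom.mk'_apply, AddMonoidHom.comp_apply]
  rw [gProj_apply X.isInternal _ hx]
  by_cases hk : i + j = k
  · rw [if_pos hk, if_pos (by omega)]
  · rw [if_neg hk, if_neg (by omega)]
    simp

/-- The differential of `N ⊗_A X`, with `∂ (n ⊗ x) = ∂ n ⊗ x + (-1) ^ |n| n ⊗ ∂ x`. -/
def tensorD : TensorCarrier f N X →+ TensorCarrier f N X :=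
  tlift f ((tmul f N X).comp N.d + ((tmul f N X).comp (N.twist 1)).compl₂ X.d) (by
    intro i n hn j a ha k x hx
    simp only [AddMonoidHom.add_apply, AddMonoidHom.compl₂_apply, AddMonoidHom.comp_apply]
    rw [N.twist_apply 1 hn, N.twist_apply 1 (N.smul_mem' hn ha), N.leibniz i n hn a,
      X.d_lsmul (f.mem ha), ← f.d]
    simp only [map_add, map_zsmul, AddMonoidHom.add_apply, AddMonoidHom.smul_apply, tmul_smul,
      one_mul, smul_smul, sgn_add, add_assoc, mul_comm (sgn i) (sgn j)])

lemma tensorD_tmul {i : ℤ} {n : N} (hn : n ∈ N.gr i) (x : X) :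
    tensorD f N X (tmul f N X n x)
      = tmul f N X (N.d n) x + sgn i • tmul f N X n (X.d x) := by
  rw [tensorD, tlift_tmul]
  simp only [AddMonoidHom.add_apply, AddMonoidHom.compl₂_apply, AddMonoidHom.comp_apply]
  rw [N.twist_apply 1 hn]
  simp

/-- The right DG module `N ⊗_A X` over `C`, for a right DG module `N` over `A`, a right DG module
`X` over `C` and a homomorphism `f : A → C`: it is the quotient of `N ⊗ X` by the relations
`n a ⊗ x = n ⊗ a x`, and `C` acts through `X`. -/
def tensor : DGMod C where
  carrier := TensorCarrier f N X
  gr := tensorGr f N X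
  isInternal := by
    refine isInternal_of_proj (tensorProj f N X) ?_ ?_
    · intro n i t ht
      induction ht using AddSubgroup.closure_induction with
      | mem t ht =>
        obtain ⟨a, b, h, n, hn, x, hx, rfl⟩ := ht
        rw [tensorProj_tmul f N X _ hn hx, h]
      | zero => simp
      | add s t _ _ hs ht => rw [map_add, hs, ht]; split_ifs <;> simp
      | neg s _ hs => rw [map_neg, hs]; split_ifs <;> simp
    · intro p h0 hadd hh t
      refine tensor_induction f h0 hadd ?_ t
      intro i n hn j x hx
      exact hh _ _ (tmul_mem f rfl hn hx)
  smul_mem := by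
    intro i j t ht c hc
    induction ht using AddSubgroup.closure_induction with
    | mem t ht =>
      obtain ⟨a, b, h, n, hn, x, hx, rfl⟩ := ht
      exact tmul_mem f (by omega) hn (X.smul_mem' hx hc)
    | zero => rw [smul_zero]; exact zero_mem _
    | add s t _ _ hs ht => rw [smul_add]; exact add_mem hs ht
    | neg s _ hs => rw [smul_neg]; exact neg_mem hs
  d := tensorD f N X
  d_mem := by
    intro i t ht
    induction ht using AddSubgroup.closure_induction with
    | mem t ht =>
      obtain ⟨a, b, h, n, hn, x, hx, rfl⟩ := ht
      rw [tensorD_tmul f N X hn]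
      exact add_mem (tmul_mem f (by omega) (N.d_mem _ _ hn) hx)
        (zsmul_mem (tmul_mem f (by omega) hn (X.d_mem _ _ hx)) _)
    | zero => rw [map_zero]; exact zero_mem _
    | add s t _ _ hs ht => rw [map_add]; exact add_mem hs ht
    | neg s _ hs => rw [map_neg]; exact neg_mem hs
  d_d := by
    intro t
    refine tensor_ext f (g := (tensorD f N X).comp (tensorD f N X)) (h := 0) ?_ t
    intro i n hn j x hx
    simp only [AddMonoidHom.comp_apply, AddMonoidHom.zero_apply]
    rw [tensorD_tmul f N X hn, map_add, map_zsmul, tensorD_tmul f N X (N.d_mem _ _ hn),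
      tensorD_tmul f N X hn, N.d_d, X.d_d, sub_eq_add_neg, sgn_add, sgn_odd (n := -1) (by decide)]
    simp
  leibniz := by
    intro i t ht c
    induction ht using AddSubgroup.closure_induction with
    | mem t ht =>
      obtain ⟨a, b, h, n, hn, x, hx, rfl⟩ := ht
      rw [tmul_rsmul, tmul_rsmul, tensorD_tmul f N X hn, tensorD_tmul f N X hn,
        X.leibniz b x hx, ← h, sgn_add]
      simp only [map_add, map_zsmul, smul_add, tmul_rsmul, smul_smul, add_assoc]
      rw [smul_comm _ (sgn a), tmul_rsmul]
    | zero => simp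
    | add s t _ _ hs ht =>
      simp only [smul_add, map_add, hs, ht]
      abel
    | neg s _ hs =>
      simp only [smul_neg, map_neg, hs]
      abel

end Tensor

/-! ### The enveloping algebra -/

section Envelope

variable {A B : DGAlg R} (f : DGAlgHom A B)

/-- `B ⊗_A B` as a right DG module over `B`. -/
def envMod : DGMod B := tensor f (DGMod.restrict f (DGMod.self B)) (DGMod.self B)

/-- The underlying abelian group of `B ⊗_A B`. -/
def Env : Type u := (envMod f).carrier

instance : AddCommGroup (Env f) := (envMod f).grp

/-- The pure tensor `b ⊗ c` in `B ⊗_A B`, as a biadditive map. -/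
def et : B →+ B →+ Env f := tmul f (DGMod.restrict f (DGMod.self B)) (DGMod.self B)

lemma et_smul (b : B) (a : A) (c : B) : et f (b * f a) c = et f b (f a * c) := by
  have h := tmul_smul f (DGMod.restrict f (DGMod.self B)) (DGMod.self B) b a c
  rw [DGMod.self_lsmul] at h
  exact h

/-- The component of degree `k` of `B ⊗_A B`. -/
def envGr (k : ℤ) : AddSubgroup (Env f) := (envMod f).gr k

/-- The differential of `B ⊗_A B`. -/
def envD : Env f →+ Env f := (envMod f).d

lemma envGr_eq (k : ℤ) : envGr f k = AddSubgroup.closure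
    {t | ∃ i j, i + j = k ∧ ∃ b ∈ B.gr i, ∃ c ∈ B.gr j, t = et f b c} := rfl

lemma et_mem {i j k : ℤ} (h : i + j = k) {b c : B} (hb : b ∈ B.gr i) (hc : c ∈ B.gr j) :
    et f b c ∈ envGr f k :=
  tmul_mem (N := DGMod.restrict f (DGMod.self B)) (X := DGMod.self B) f h hb hc

lemma et_d {i : ℤ} {b : B} (hb : b ∈ B.gr i) (c : B) :
    envD f (et f b c) = et f (B.d b) c + sgn i • et f b (B.d c) :=
  tensorD_tmul f (DGMod.restrict f (DGMod.self B)) (DGMod.self B) hb c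

lemma et_rsmul (b c e : B) :
    (envMod f).rmul e (et f b c) = et f b (c * e) := rfl

lemma env_ext {P : Type*} [AddCommGroup P] {g h : Env f →+ P}
    (H : ∀ i, ∀ b ∈ B.gr i, ∀ j, ∀ c ∈ B.gr j, g (et f b c) = h (et f b c)) (t : Env f) :
    g t = h t :=
  tensor_ext (N := DGMod.restrict f (DGMod.self B)) (X := DGMod.self B) f H t

/-- The additive map out of `B ⊗_A B` induced by a balanced biadditive map. -/
def envLift {P : Type*} [AddCommGroup P] (β : B →+ B →+ P)
    (h : ∀ i, ∀ b ∈ B.gr i, ∀ j, ∀ a ∈ A.gr j, ∀ k, ∀ c ∈ B.gr k,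
      β (b * f a) c = β b (f a * c)) : Env f →+ P :=
  tlift (N := DGMod.restrict f (DGMod.self B)) (X := DGMod.self B) f β (by
    intro i n hn j a ha k x hx
    exact (h i n hn j a ha k x hx).trans (congrArg (β n) (DGMod.self_lsmul B (f a) x).symm))

lemma envLift_et {P : Type*} [AddCommGroup P] (β : B →+ B →+ P) (h) (b c : B) :
    envLift f β h (et f b c) = β b c := rfl

/-- Left multiplication by `b ⊗ 1`. -/
def envL (b : B) : Env f →+ Env f :=
  envLift f ((et f).comp (AddMonoidHom.mulLeft b)) (by
    intro i c _ j a _ k e _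
    simp only [AddMonoidHom.comp_apply, AddMonoidHom.coe_mulLeft]
    rw [← mul_assoc, et_smul])

lemma envL_et (b c e : B) : envL f b (et f c e) = et f (b * c) e := rfl

/-- Left multiplication by `1 ⊗ b`. -/
def envR : B →+ Env f →+ Env f := (envMod f).lsmul

lemma envR_et {i j : ℤ} {b c : B} (hb : b ∈ B.gr i) (hc : c ∈ B.gr j) (e : B) :
    envR f b (et f c e) = sgn (i * j) • et f c (b * e) := by
  refine B.ext_homog (f := (envR f b).comp (et f c))
    (g := sgn (i * j) • (et f c).comp (AddMonoidHom.mulLeft b)) ?_ e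
  intro k e he
  refine ((envMod f).lsmul_apply hb (et_mem f rfl hc he)).trans ?_
  change (sgn (i * (j + k)) • et f c (e * b) : Env f) = sgn (i * j) • et f c (b * e)
  rw [B.gcomm _ _ e he b hb, map_zsmul]
  refine (smul_smul _ _ _).trans ?_
  rw [← sgn_add]
  congr 1
  exact sgn_congr ⟨i * k, by ring⟩

/-- The multiplication of `B ⊗_A B`. -/
def envMul : Env f →+ Env f →+ Env f :=
  envLift f (AddMonoidHom.mk' (fun b => AddMonoidHom.mk' (fun c => (envL f b).comp (envR f c))
      (by intro c e; ext t; simp))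
    (by
      intro b b'
      ext c t
      simp only [AddMonoidHom.mk'_apply, AddMonoidHom.comp_apply, AddMonoidHom.add_apply]
      refine env_ext f (g := envL f (b + b')) (h := envL f b + envL f b') ?_ _
      intro i x _ j y _
      simp only [AddMonoidHom.add_apply, envL_et, add_mul, map_add])) (by
    intro i b hb j a ha k c hc
    ext t
    simp only [AddMonoidHom.mk'_apply, AddMonoidHom.comp_apply]
    refine env_ext f (g := (envL f (b * f a)).comp (envR f c))
      (h := (envL f b).comp (envR f (f a * c))) ?_ t
    intro l x hx m y hy
    simp only [AddMonoidHom.comp_apply]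
    rw [envR_et f hc hx, envR_et f (B.mul_mem (f.mem ha) hc) hx, map_zsmul, map_zsmul,
      envL_et, envL_et, mul_assoc b, B.gcomm _ _ _ (f.mem ha) x hx, mul_smul_comm, map_zsmul,
      AddMonoidHom.smul_apply, ← mul_assoc b, et_smul, smul_smul, ← sgn_add, mul_assoc]
    congr 1
    exact sgn_congr ⟨0, by ring⟩)

lemma envMul_et (b c : B) (t : Env f) : envMul f (et f b c) t = envL f b (envR f c t) := rfl

lemma envMul_et_et {i j : ℤ} (b : B) {c x : B} (hc : c ∈ B.gr i) (hx : x ∈ B.gr j) (y : B) :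
    envMul f (et f b c) (et f x y) = sgn (i * j) • et f (b * x) (c * y) := by
  rw [envMul_et, envR_et f hc hx, map_zsmul, envL_et]

lemma envL_mul (b c : B) (t : Env f) : envL f (b * c) t = envL f b (envL f c t) := by
  refine env_ext f (g := envL f (b * c)) (h := (envL f b).comp (envL f c)) ?_ t
  intro i x _ j y _
  simp only [AddMonoidHom.comp_apply, envL_et, mul_assoc]

lemma envR_mul (b c : B) (t : Env f) : envR f (b * c) t = envR f b (envR f c t) :=
  (envMod f).lsmul_mul b c t

lemma envL_one (t : Env f) : envL f 1 t = t := by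
  refine env_ext f (g := envL f 1) (h := AddMonoidHom.id _) ?_ t
  intro i x _ j y _
  simp [envL_et]

lemma envR_one (t : Env f) : envR f 1 t = t := (envMod f).lsmul_one t

lemma envR_envL {i j : ℤ} {b c : B} (hb : b ∈ B.gr i) (hc : c ∈ B.gr j) (t : Env f) :
    envR f b (envL f c t) = sgn (i * j) • envL f c (envR f b t) := by
  refine env_ext f (g := (envR f b).comp (envL f c))
    (h := sgn (i * j) • (envL f c).comp (envR f b)) ?_ t
  intro k x hx l y _
  simp only [AddMonoidHom.comp_apply, AddMonoidHom.smul_apply]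
  rw [envL_et, envR_et f hb (B.mul_mem hc hx), envR_et f hb hx, map_zsmul, envL_et, smul_smul,
    ← sgn_add, mul_add]

instance : Ring (Env f) where
  __ := (inferInstance : AddCommGroup (Env f))
  mul s t := envMul f s t
  one := et f 1 1
  left_distrib s := map_add (envMul f s)
  right_distrib s t u := by
    change envMul f (s + t) u = envMul f s u + envMul f t u
    simp
  zero_mul t := by
    change envMul f 0 t = 0
    simp
  mul_zero t := map_zero (envMul f t)
  one_mul t := by
    change envMul f (et f 1 1) t = t
    rw [envMul_et, envR_one, envL_one]
  mul_one t := by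
    change envMul f t (et f 1 1) = t
    refine env_ext f (g := (envMul f).flip (et f 1 1)) (h := AddMonoidHom.id _) ?_ t
    intro i b _ j c hc
    rw [AddMonoidHom.flip_apply, envMul_et_et f b hc B.one_mem]
    simp
  mul_assoc s t u := by
    change envMul f (envMul f s t) u = envMul f s (envMul f t u)
    refine env_ext f (g := ((envMul f).flip u).comp ((envMul f).flip t))
      (h := (envMul f).flip (envMul f t u)) ?_ s
    intro i b _ j c hc
    refine env_ext f (g := ((envMul f).flip u).comp (envMul f (et f b c)))
      (h := (envMul f (et f b c)).comp ((envMul f).flip u)) ?_ t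
    intro k x hx l y _
    simp only [AddMonoidHom.comp_apply, AddMonoidHom.flip_apply]
    rw [envMul_et_et f b hc hx, map_zsmul, AddMonoidHom.smul_apply, envMul_et, envMul_et,
      envMul_et, envR_envL f hc hx, map_zsmul, envL_mul, envR_mul]

lemma et_mul_et {i j : ℤ} (b : B) {c x : B} (hc : c ∈ B.gr i) (hx : x ∈ B.gr j) (y : B) :
    et f b c * et f x y = sgn (i * j) • et f (b * x) (c * y) := envMul_et_et f b hc hx y

lemma env_one : (1 : Env f) = et f 1 1 := rfl

lemma et_mul (b c : B) (t : Env f) : et f b c * t = envL f b (envR f c t) := rfl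

/-- The structure map `R → B ⊗_A B`, `r ↦ r ⊗ 1`. -/
def envAlgebraMap : R →+* Env f where
  toFun r := et f (algebraMap R B r) 1
  map_one' := by rw [RingHom.map_one, env_one]
  map_zero' := by rw [RingHom.map_zero, map_zero, AddMonoidHom.zero_apply]
  map_add' r s := by rw [RingHom.map_add, map_add, AddMonoidHom.add_apply]
  map_mul' r s := by
    rw [et_mul_et f _ B.one_mem (SetLike.algebraMap_mem_graded B.gr s)]
    simp

instance : Algebra R (Env f) :=
  (envAlgebraMap f).toAlgebra' (by
    intro r t
    change envMul f (et f (algebraMap R B r) 1) t = envMul f t (et f (algebraMap R B r) 1)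
    refine env_ext f (g := envMul f (et f (algebraMap R B r) 1))
      (h := (envMul f).flip (et f (algebraMap R B r) 1)) ?_ t
    intro i b hb j c hc
    have hr := SetLike.algebraMap_mem_graded B.gr r
    rw [AddMonoidHom.flip_apply, envMul_et_et f _ B.one_mem hb, envMul_et_et f _ hc hr]
    simp [Algebra.commutes])

lemma env_algebraMap (r : R) : algebraMap R (Env f) r = et f (algebraMap R B r) 1 := rfl

lemma env_mul_mem {i j : ℤ} {s t : Env f} (hs : s ∈ envGr f i) (ht : t ∈ envGr f j) :
    s * t ∈ envGr f (i + j) := by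
  rw [envGr_eq] at hs ht
  induction hs using AddSubgroup.closure_induction with
  | mem s hs =>
    obtain ⟨a, b, h, x, hx, y, hy, rfl⟩ := hs
    induction ht using AddSubgroup.closure_induction with
    | mem t ht =>
      obtain ⟨a', b', h', x', hx', y', hy', rfl⟩ := ht
      rw [et_mul_et f x hy hx' y']
      exact zsmul_mem (et_mem f (by omega) (B.mul_mem hx hx') (B.mul_mem hy hy')) _
    | zero => rw [mul_zero]; exact zero_mem _
    | add u v _ _ hu hv => rw [mul_add]; exact add_mem hu hv
    | neg u _ hu => rw [mul_neg]; exact neg_mem hu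
  | zero => rw [zero_mul]; exact zero_mem _
  | add u v _ _ hu hv => rw [add_mul]; exact add_mem hu hv
  | neg u _ hu => rw [neg_mul]; exact neg_mem hu

lemma env_gcomm {i j : ℤ} {s t : Env f} (hs : s ∈ envGr f i) (ht : t ∈ envGr f j) :
    s * t = sgn (i * j) • (t * s) := by
  rw [envGr_eq] at hs ht
  induction hs using AddSubgroup.closure_induction with
  | mem s hs =>
    obtain ⟨a, b, h, x, hx, y, hy, rfl⟩ := hs
    induction ht using AddSubgroup.closure_induction with
    | mem t ht =>
      obtain ⟨a', b', h', x', hx', y', hy', rfl⟩ := ht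
      rw [et_mul_et f x hy hx' y', et_mul_et f x' hy' hx y, B.gcomm _ _ x hx x' hx',
        B.gcomm _ _ y hy y' hy', map_zsmul, map_zsmul, AddMonoidHom.smul_apply, smul_smul,
        smul_smul, smul_smul, ← sgn_add, ← sgn_add, ← sgn_add]
      congr 1
      rw [← h, ← h']
      exact sgn_congr ⟨- (a * b'), by ring⟩
    | zero => simp
    | add u v _ _ hu hv => rw [mul_add, hu, hv, add_mul, smul_add]
    | neg u _ hu => rw [mul_neg, hu, neg_mul, smul_neg]
  | zero => simp
  | add u v _ _ hu hv => rw [add_mul, hu, hv, mul_add, smul_add]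
  | neg u _ hu => rw [neg_mul, hu, mul_neg, smul_neg]

lemma env_odd_sq {i : ℤ} (hi : Odd i) {s : Env f} (hs : s ∈ envGr f i) : s * s = 0 := by
  rw [envGr_eq] at hs
  induction hs using AddSubgroup.closure_induction with
  | mem s hs =>
    obtain ⟨a, b, h, x, hx, y, hy, rfl⟩ := hs
    rw [et_mul_et f x hy hx y]
    rcases Int.even_or_odd a with ha | ha
    · have hb : Odd b := by
        rw [← h] at hi
        exact (Int.odd_add'.1 hi).2 ha
      simp [B.odd_sq b hb y hy]
    · simp [B.odd_sq a ha x hx]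
  | zero => simp
  | add u v hu' hv' hu hv =>
    rw [← envGr_eq] at hu' hv'
    have h := env_gcomm f hu' hv'
    rw [sgn_odd (hi.mul hi)] at h
    rw [mul_add, add_mul, add_mul, hu, hv, h]
    simp
  | neg u _ hu => rw [neg_mul_neg, hu]

lemma envD_envL {a : ℤ} {x : B} (hx : x ∈ B.gr a) (u : Env f) :
    envD f (envL f x u) = envL f (B.d x) u + sgn a • envL f x (envD f u) := by
  refine env_ext f (g := (envD f).comp (envL f x))
    (h := envL f (B.d x) + sgn a • (envL f x).comp (envD f)) ?_ u
  intro k p hp l q _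
  simp only [AddMonoidHom.comp_apply, AddMonoidHom.add_apply, AddMonoidHom.smul_apply]
  rw [envL_et, envL_et, et_d f hp, et_d f (B.mul_mem hx hp), B.leibniz a x hx p]
  simp only [map_add, map_zsmul, AddMonoidHom.add_apply, AddMonoidHom.smul_apply, envL_et,
    sgn_add, smul_add, smul_smul, add_assoc]

lemma envD_envR {a : ℤ} {x : B} (hx : x ∈ B.gr a) (u : Env f) :
    envD f (envR f x u) = envR f (B.d x) u + sgn a • envR f x (envD f u) :=
  (envMod f).d_lsmul hx u

lemma env_leibniz {i : ℤ} {s : Env f} (hs : s ∈ envGr f i) (t : Env f) :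
    envD f (s * t) = envD f s * t + sgn i • (s * envD f t) := by
  rw [envGr_eq] at hs
  induction hs using AddSubgroup.closure_induction with
  | mem s hs =>
    obtain ⟨a, b, h, x, hx, y, hy, rfl⟩ := hs
    rw [et_mul, et_mul, envD_envL f hx, envD_envR f hy, et_d f hx, add_mul, smul_mul_assoc,
      et_mul, et_mul, ← h, sgn_add]
    simp only [map_add, map_zsmul, smul_add, smul_smul, add_assoc]
  | zero => simp
  | add u v _ _ hu hv =>
    rw [add_mul, map_add, hu, hv, map_add, add_mul, add_mul, smul_add]
    abel
  | neg u _ hu =>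
    rw [neg_mul, map_neg, hu, map_neg, neg_mul, neg_mul, smul_neg]
    abel

lemma envD_algebraMap_mul (r : R) (t : Env f) :
    envD f (algebraMap R (Env f) r * t) = algebraMap R (Env f) r * envD f t := by
  have hr := SetLike.algebraMap_mem_graded B.gr r
  have h0 : B.d (algebraMap R B r) = 0 := by
    rw [Algebra.algebraMap_eq_smul_one, map_smul, B.d_one, smul_zero]
  rw [env_algebraMap, env_leibniz f (et_mem f (add_zero 0) hr B.one_mem), et_d f hr, h0, B.d_one]
  simp

lemma env_isInternal : DirectSum.IsInternal (envGr f) := (envMod f).isInternal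

/-- The component of degree `k` of `B ⊗_A B`, as an `R`-submodule. -/
def envGrR (k : ℤ) : Submodule R (Env f) where
  __ := envGr f k
  smul_mem' r t ht := by
    have hr := SetLike.algebraMap_mem_graded B.gr r
    rw [Algebra.smul_def, env_algebraMap, ← zero_add k]
    exact env_mul_mem f (et_mem f (add_zero 0) hr B.one_mem) ht

instance : GradedAlgebra (envGrR f) where
  one_mem := et_mem f (add_zero 0) B.one_mem B.one_mem
  mul_mem _ _ _ _ hs ht := env_mul_mem f hs ht
  __ := DirectSum.IsInternal.chooseDecomposition (envGrR f) (env_isInternal f)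

/-- The enveloping DG algebra `B ⊗_A B`, with
`(b ⊗ c) (b' ⊗ c') = (-1) ^ (|c| |b'|) (b b' ⊗ c c')` and
`d (b ⊗ c) = d b ⊗ c + (-1) ^ |b| b ⊗ d c`. -/
def envelope : DGAlg R where
  carrier := Env f
  gr := envGrR f
  gr_neg k hk := by
    rw [eq_bot_iff]
    intro t ht
    change t ∈ envGr f k at ht
    rw [envGr_eq] at ht
    rw [Submodule.mem_bot]
    induction ht using AddSubgroup.closure_induction with
    | mem t ht =>
      obtain ⟨i, j, h, b, hb, c, hc, rfl⟩ := ht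
      rcases lt_or_ge i 0 with hi | hi
      · rw [B.gr_neg i hi, Submodule.mem_bot] at hb
        simp [hb]
      · rw [B.gr_neg j (by omega), Submodule.mem_bot] at hc
        simp [hc]
    | zero => rfl
    | add u v _ _ hu hv => rw [hu, hv, add_zero]
    | neg u _ hu => rw [hu, neg_zero]
  gcomm _ _ _ hs _ ht := env_gcomm f hs ht
  odd_sq _ hi _ hs := env_odd_sq f hi hs
  d :=
    { toFun := envD f
      map_add' := map_add (envD f)
      map_smul' := by
        intro r t
        rw [Algebra.smul_def, envD_algebraMap_mul, RingHom.id_apply, Algebra.smul_def] }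
  d_mem := (envMod f).d_mem
  d_d := (envMod f).d_d
  leibniz _ _ hs t := env_leibniz f hs t

/-- The homomorphism `B → B ⊗_A B`, `b ↦ b ⊗ 1`. -/
def inl : DGAlgHom B (envelope f) where
  toFun b := et f b 1
  map_one' := rfl
  map_zero' := by simp; rfl
  map_add' b c := by simp; rfl
  map_mul' b c := by
    refine B.ext_homog (f := ((et f).flip 1).comp (AddMonoidHom.mulLeft b))
      (g := (AddMonoidHom.mulLeft (et f b 1)).comp ((et f).flip 1)) ?_ c
    intro i c hc
    simp [et_mul_et f b B.one_mem hc]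
  commutes' r := rfl
  map_mem i b hb := et_mem f (add_zero i) hb B.one_mem
  map_d b := by
    refine B.ext_homog (f := ((et f).flip 1).comp B.d.toAddMonoidHom)
      (g := (envD f).comp ((et f).flip 1)) ?_ b
    intro i b hb
    simp [et_d f hb, B.d_one]

/-- The homomorphism `B → B ⊗_A B`, `b ↦ 1 ⊗ b`. -/
def inr : DGAlgHom B (envelope f) where
  toFun b := et f 1 b
  map_one' := rfl
  map_zero' := map_zero (et f 1)
  map_add' b c := map_add (et f 1) b c
  map_mul' b c := by
    refine B.ext_homog (f := (et f 1).comp (AddMonoidHom.mulRight c))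
      (g := (AddMonoidHom.mulRight (et f 1 c)).comp (et f 1)) ?_ b
    intro i b hb
    simp [et_mul_et f 1 hb B.one_mem]
  commutes' r := by
    have h := et_smul f 1 (algebraMap R A r) 1
    have h' : f (algebraMap R A r) = algebraMap R B r := f.toAlgHom.commutes r
    rw [h', one_mul, mul_one] at h
    exact h.symm
  map_mem i b hb := et_mem f (zero_add i) B.one_mem hb
  map_d b := by
    change et f 1 (B.d b) = envD f (et f 1 b)
    simp [et_d f B.one_mem, B.d_one]

/-- The multiplication map `B ⊗_A B → B`, `b ⊗ c ↦ b c`, as an additive map. -/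
def multHom : Env f →+ B :=
  envLift f AddMonoidHom.mul (by
    intro i b _ j a _ k c _
    simp [mul_assoc])

lemma multHom_et (b c : B) : multHom f (et f b c) = b * c := rfl

lemma multHom_mem {k : ℤ} {t : Env f} (ht : t ∈ envGr f k) : multHom f t ∈ B.gr k := by
  rw [envGr_eq] at ht
  induction ht using AddSubgroup.closure_induction with
  | mem t ht =>
    obtain ⟨i, j, h, b, hb, c, hc, rfl⟩ := ht
    rw [multHom_et, ← h]
    exact B.mul_mem hb hc
  | zero => rw [map_zero]; exact zero_mem _
  | add u v _ _ hu hv => rw [map_add]; exact add_mem hu hv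
  | neg u _ hu => rw [map_neg]; exact neg_mem hu

/-- The multiplication map `B ⊗_A B → B`, `b ⊗ c ↦ b c`, as a homomorphism of DG algebras. -/
def mult : DGAlgHom (envelope f) B where
  toFun := multHom f
  map_one' := by
    change multHom f (et f 1 1) = 1
    rw [multHom_et, one_mul]
  map_zero' := map_zero (multHom f)
  map_add' := map_add (multHom f)
  map_mul' s t := by
    refine env_ext f (g := (multHom f).comp ((envMul f).flip t))
      (h := (AddMonoidHom.mulRight (multHom f t)).comp (multHom f)) ?_ s
    intro i b _ j c hc
    refine env_ext f (g := (multHom f).comp (envMul f (et f b c)))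
      (h := (AddMonoidHom.mulLeft (b * c)).comp (multHom f)) ?_ t
    intro k x hx l y _
    simp only [AddMonoidHom.comp_apply, AddMonoidHom.coe_mulLeft]
    rw [envMul_et_et f b hc hx, map_zsmul, multHom_et, multHom_et, mul_assoc, mul_assoc,
      ← mul_assoc c x, B.gcomm _ _ c hc x hx, smul_mul_assoc, mul_smul_comm, mul_assoc]
  commutes' r := by
    change multHom f (et f (algebraMap R B r) 1) = _
    rw [multHom_et, mul_one]
  map_mem _ _ ht := multHom_mem f ht
  map_d t := by
    refine env_ext f (g := (multHom f).comp (envD f))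
      (h := B.d.toAddMonoidHom.comp (multHom f)) ?_ t
    intro i b hb j c _
    simp only [AddMonoidHom.comp_apply, LinearMap.toAddMonoidHom_coe]
    rw [et_d f hb, map_add, map_zsmul, multHom_et, multHom_et, multHom_et, B.leibniz i b hb]

end Envelope

/-! ### The diagonal ideal and naive liftability -/

section Diagonal

variable {A B : DGAlg R} (f : DGAlgHom A B)

/-- The multiplication map `B ⊗_A B → B` as a homomorphism of right DG modules over
`B ⊗_A B`. -/
def multDG : DGHom (DGMod.self (envelope f)) (DGMod.restrict (mult f) (DGMod.self B)) where
  toFun t := mult f t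
  map_add' s t := map_add (mult f).toAlgHom s t
  map_smul' c t := (mult f).map_mul' t c.unop
  map_mem := (mult f).map_mem
  map_d := (mult f).map_d

/-- The diagonal ideal `J`, the kernel of `B ⊗_A B → B`. -/
def diag : DGMod (envelope f) := (multDG f).ker

/-- The inclusion `J → B ⊗_A B`. -/
def diagVal : diag f →+ envelope f := (LinearMap.ker (multDG f).toLinearMap).subtype.toAddMonoidHom

lemma diagVal_injective : Function.Injective (diagVal f) := Subtype.val_injective

/-- An element of `B ⊗_A B` in the kernel of the multiplication map, as an element of `J`. -/
def diagMk (t : envelope f) (h : mult f t = 0) : diag f :=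
  (⟨t, h⟩ : LinearMap.ker (multDG f).toLinearMap)

lemma diagVal_mk (t : envelope f) (h : mult f t = 0) : diagVal f (diagMk f t h) = t := rfl

lemma diagVal_rsmul (y : diag f) (c : envelope f) : diagVal f (y <• c) = diagVal f y * c := rfl

lemma diagVal_mem {n : ℤ} {y : diag f} :
    y ∈ (diag f).gr n ↔ diagVal f y ∈ (envelope f).gr n := Iff.rfl

lemma diagVal_lsmul (c : envelope f) (y : diag f) :
    diagVal f ((diag f).lsmul c y) = c * diagVal f y := by
  refine (envelope f).ext_homog (f := (diagVal f).comp ((diag f).lsmul.flip y))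
    (g := AddMonoidHom.mulRight (diagVal f y)) ?_ c
  intro i c hc
  refine (diag f).ext_homog (f := (diagVal f).comp ((diag f).lsmul c))
    (g := (AddMonoidHom.mulLeft c).comp (diagVal f)) ?_ y
  intro j y hy
  simp only [AddMonoidHom.comp_apply, AddMonoidHom.coe_mulLeft]
  rw [(diag f).lsmul_apply hc hy, map_zsmul, diagVal_rsmul]
  exact ((envelope f).gcomm i j c hc _ ((diagVal_mem f).1 hy)).symm

lemma inl_eq_inr (a : A) : inl f (f a) = inr f (f a) := by
  have := et_smul f 1 a 1
  rw [one_mul, mul_one] at this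
  exact this

lemma mult_delta (b : B) : mult f (inl f b - inr f b) = 0 := by
  change multHom f (et f b 1 - et f 1 b) = 0
  rw [map_sub, multHom_et, multHom_et, mul_one, one_mul, sub_self]

/-- The universal derivation `δ b = b ⊗ 1 - 1 ⊗ b`, as an additive map `B → J`. -/
def deltaHom : B →+ diag f :=
  AddMonoidHom.mk' (fun b => diagMk f (inl f b - inr f b) (mult_delta f b)) (by
    intro b c
    apply diagVal_injective
    rw [map_add (diagVal f), diagVal_mk, diagVal_mk, diagVal_mk]
    simp only [map_add]
    abel)

lemma diagVal_delta (b : B) : diagVal f (deltaHom f b) = inl f b - inr f b := rfl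

variable (N : DGMod B)

/-- The homomorphism `π_N : N ⊗_A B → N`, `n ⊗ b ↦ n b`, of right DG modules over `B`. -/
def piHom : DGHom (tensor f (DGMod.restrict f N) (DGMod.self B)) N :=
  let g : TensorCarrier f (DGMod.restrict f N) (DGMod.self B) →+ N :=
    tlift (N := DGMod.restrict f N) (X := DGMod.self B) f N.rmul.flip (by
      intro i n _ j a _ k b _
      refine Eq.trans ?_ (congrArg (N.rmul.flip n) (DGMod.self_lsmul B (f a) b).symm)
      exact op_smul_op_smul (α := B) (β := N) n (f a) b)
  have hg : ∀ (n : N) (b : B),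
      g (tmul f (DGMod.restrict f N) (DGMod.self B) n b) = n <• b := fun _ _ => rfl
  { toFun := g
    map_add' := map_add g
    map_smul' := by
      intro c t
      refine tensor_ext f (g := g.comp (tensorSMul f _ _ c.unop))
        (h := (N.rmul c.unop).comp g) ?_ t
      intro i n _ j b _
      exact (op_smul_op_smul (α := B) (β := N) n b c.unop).symm
    map_mem := by
      intro k t ht
      change t ∈ tensorGr f (DGMod.restrict f N) (DGMod.self B) k at ht
      unfold tensorGr at ht
      induction ht using AddSubgroup.closure_induction with
      | mem t ht =>
        obtain ⟨i, j, h, n, hn, b, hb, rfl⟩ := ht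
        rw [← h]
        exact N.smul_mem' hn hb
      | zero => exact (map_zero g).symm ▸ zero_mem _
      | add u v _ _ hu hv => exact (map_add g u v).symm ▸ add_mem hu hv
      | neg u _ hu => exact (map_neg g u).symm ▸ neg_mem hu
    map_d := by
      intro t
      refine tensor_ext f (g := g.comp (tensorD f (DGMod.restrict f N) (DGMod.self B)))
        (h := N.d.comp g) ?_ t
      intro i n hn j b _
      simp only [AddMonoidHom.comp_apply]
      rw [tensorD_tmul f (DGMod.restrict f N) (DGMod.self B) hn, map_add, map_zsmul]
      exact (N.leibniz i n hn b).symm }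

/-- `N` is naively liftable to `A`: the map `π_N : N ⊗_A B → N` has a right inverse in the category
of DG modules over `B`. -/
def NaivelyLiftable : Prop :=
  ∃ s : DGHom N (tensor f (DGMod.restrict f N) (DGMod.self B)), ∀ x, piHom f N (s x) = x

end Diagonal

/-! ### Left DG modules, given by their homogeneous components -/

/-- A left DG module over `B`, given by its homogeneous components `comp n`, the multiplication maps
`B_i × M_j → M_k` for `i + j = k`, and the differentials `M_n → M_{n-1}`. -/
structure LeftDGMod (B : DGAlg R) where
  comp : ℤ → Type u
  [grp : ∀ n, AddCommGroup (comp n)]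
  smul : ∀ {i j k : ℤ}, i + j = k → B.gr i →+ comp j →+ comp k
  d : ∀ n, comp n →+ comp (n - 1)
  one_smul : ∀ {j : ℤ} (h : 0 + j = j) (x : comp j), smul h ⟨1, B.one_mem⟩ x = x
  mul_smul : ∀ {i j k l m : ℤ} (h : i + j + k = l) (h₁ : j + k = m) (h₂ : i + m = l)
    (a : B.gr i) (b : B.gr j) (x : comp k),
    smul h ⟨a * b, B.mul_mem a.2 b.2⟩ x = smul h₂ a (smul h₁ b x)
  d_d : ∀ n (x : comp n), d (n - 1) (d n x) = 0
  leibniz : ∀ {i j : ℤ} (h₁ : i - 1 + j = i + j - 1) (h₂ : i + (j - 1) = i + j - 1)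
    (b : B.gr i) (x : comp j),
    d (i + j) (smul rfl b x) = smul h₁ ⟨B.d b, B.d_mem i b b.2⟩ x + sgn i • smul h₂ b (d j x)

attribute [instance] LeftDGMod.grp

/-- A homomorphism of left DG modules: a family of additive maps between homogeneous components,
compatible with the multiplications and with the differentials. -/
structure LeftDGHom {B : DGAlg R} (M N : LeftDGMod B) where
  app : ∀ n, M.comp n →+ N.comp n
  map_smul : ∀ {i j k : ℤ} (h : i + j = k) (b : B.gr i) (x : M.comp j),
    app k (M.smul h b x) = N.smul h b (app j x)
  map_d : ∀ n (x : M.comp n), app (n - 1) (M.d n x) = N.d n (app n x)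

/-- The sequence `0 → K → L → M → 0` with maps `i` and `p` splits in the category of left DG
modules: there are a retraction `r` of `i` and a section `s` of `p` with `i r + s p = 1`. -/
def Splits {B : DGAlg R} {K L M : LeftDGMod B} (i : LeftDGHom K L) (p : LeftDGHom L M) : Prop :=
  ∃ (r : LeftDGHom L K) (s : LeftDGHom M L),
    (∀ n x, r.app n (i.app n x) = x) ∧ (∀ n x, p.app n (s.app n x) = x) ∧
      ∀ n x, i.app n (r.app n x) + s.app n (p.app n x) = x

/-- The left DG module whose components are subgroups of a fixed abelian group `E`. -/
def LeftDGMod.ofFamily {B : DGAlg R} {E : Type u} [AddCommGroup E] (act : B →+ E →+ E)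
    (dd : ℤ → E →+ E) (S : ℤ → AddSubgroup E)
    (act_one : ∀ x, act 1 x = x) (act_mul : ∀ a b x, act (a * b) x = act a (act b x))
    (dd_dd : ∀ n x, dd (n - 1) (dd n x) = 0)
    (leib : ∀ i j, ∀ b ∈ B.gr i, ∀ x,
      dd (i + j) (act b x) = act (B.d b) x + sgn i • act b (dd j x))
    (act_mem : ∀ i j, ∀ b ∈ B.gr i, ∀ x ∈ S j, act b x ∈ S (i + j))
    (dd_mem : ∀ n, ∀ x ∈ S n, dd n x ∈ S (n - 1)) : LeftDGMod B where
  comp n := S n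
  smul {i j k} h := AddMonoidHom.mk' (fun b => AddMonoidHom.mk'
      (fun x => ⟨act b x, h ▸ act_mem i j b b.2 x x.2⟩)
      (by intro x y; ext; simp)) (by intro b c; ext x; simp)
  d n := AddMonoidHom.mk' (fun x => ⟨dd n x, dd_mem n x x.2⟩) (by intro x y; ext; simp)
  one_smul _ x := Subtype.ext (act_one x)
  mul_smul _ _ _ a b x := Subtype.ext (act_mul a b x)
  d_d n x := Subtype.ext (dd_dd n x)
  leibniz {i j} _ _ b x := Subtype.ext (leib i j b b.2 x)

/-! ### Derivations, connections and the fundamental exact sequence -/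

section Hom

variable {C : DGAlg R} (Y : DGMod C) {P : Type u} [AddCommGroup P] (dP : P →+ P)

/-- The action `(c g) (x) = c (g x)` of `C` on additive maps with values in `Y`. -/
def homAct : C →+ (P →+ Y) →+ (P →+ Y) := AddMonoidHom.compHom.comp Y.lsmul

@[simp] lemma homAct_apply (c : C) (g : P →+ Y) (x : P) : homAct Y c g x = Y.lsmul c (g x) := rfl

/-- The differential `g ↦ ∂ ∘ g - (-1) ^ n g ∘ ∂` on additive maps of degree `n`. -/
def homD (n : ℤ) : (P →+ Y) →+ (P →+ Y) :=
  AddMonoidHom.compHom Y.d - sgn n • AddMonoidHom.compHom.flip dP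

@[simp] lemma homD_apply (n : ℤ) (g : P →+ Y) (x : P) :
    homD Y dP n g x = Y.d (g x) - sgn n • g (dP x) := rfl

lemma homD_homD (hP : ∀ x, dP (dP x) = 0) (n : ℤ) (g : P →+ Y) :
    homD Y dP (n - 1) (homD Y dP n g) = 0 := by
  ext x
  simp only [homD_apply, map_sub, map_zsmul, Y.d_d, hP, map_zero, AddMonoidHom.zero_apply]
  rw [sub_eq_add_neg n, sgn_add, sgn_odd (n := -1) (by decide)]
  simp

lemma homD_homAct {i : ℤ} (j : ℤ) {c : C} (hc : c ∈ C.gr i) (g : P →+ Y) :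
    homD Y dP (i + j) (homAct Y c g)
      = homAct Y (C.d c) g + sgn i • homAct Y c (homD Y dP j g) := by
  ext x
  simp only [homD_apply, homAct_apply, AddMonoidHom.add_apply, AddMonoidHom.smul_apply,
    map_sub, map_zsmul]
  rw [Y.d_lsmul hc, sgn_add, smul_sub, smul_smul]
  abel

lemma homAct_one (g : P →+ Y) : homAct Y 1 g = g := by
  ext x
  simp [Y.lsmul_one]

lemma homAct_mul (a b : C) (g : P →+ Y) : homAct Y (a * b) g = homAct Y a (homAct Y b g) := by
  ext x
  simp [Y.lsmul_mul]

end Hom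

/-- The left action of `C` on `N ⊗_A X` on pure tensors. -/
lemma tensor_lsmul {A C : DGAlg R} (f : DGAlgHom A C) (N : DGMod A) (X : DGMod C) {i l : ℤ}
    {c : C} {n : N} (hc : c ∈ C.gr i) (hn : n ∈ N.gr l) (x : X) :
    (tensor f N X).lsmul c (tmul f N X n x)
      = (sgn (i * l) • tmul f N X n (X.lsmul c x) : TensorCarrier f N X) := by
  refine X.ext_homog (f := ((tensor f N X).lsmul c).comp (tmul f N X n))
    (g := sgn (i * l) • (tmul f N X n).comp (X.lsmul c)) ?_ x
  intro k x hx
  refine ((tensor f N X).lsmul_apply hc (tmul_mem f rfl hn hx)).trans ?_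
  change (sgn (i * (l + k)) • tmul f N X n (x <• c) : TensorCarrier f N X)
    = sgn (i * l) • tmul f N X n (X.lsmul c x)
  rw [X.lsmul_apply hc hx, map_zsmul]
  rw [smul_smul, ← sgn_add, mul_add]

section Connections

variable {A B : DGAlg R} (f : DGAlgHom A B)

/-- The right DG module `N ⊗_B X` over `B ⊗_A B`, where `X` is a left module over `B` via
`b ↦ b ⊗ 1`. As a module over `B` it is viewed via `b ↦ 1 ⊗ b`. -/
def tens (N : DGMod B) (X : DGMod (envelope f)) : DGMod (envelope f) := tensor (inl f) N X

/-- The pure tensor `x ⊗ y` in `N ⊗_B X`, as a biadditive map. -/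
def tm (N : DGMod B) (X : DGMod (envelope f)) : N →+ X →+ tens f N X := tmul (inl f) N X

/-- `D` is an `A`-derivation `B → X` of degree `n`. For a right module `X` over `B ⊗_A B`, the
product `x b` is `x (1 ⊗ b)` and the product `b x` is `(b ⊗ 1) x`. -/
structure IsDerivation (X : DGMod (envelope f)) (n : ℤ) (D : B →+ X) : Prop where
  mem : ∀ i, ∀ b ∈ B.gr i, D b ∈ X.gr (i + n)
  linear : ∀ (b : B) (a : A), D (b * f a) = D b <• inr f (f a)
  leibniz : ∀ i, ∀ b ∈ B.gr i, ∀ c,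
    D (b * c) = D b <• inr f c + sgn (n * i) • X.lsmul (inl f b) (D c)

variable (N : DGMod B)

/-- `ψ : N → N ⊗_B X` is a `D`-connection of degree `n` on `N` along `X`. Here `X` is a left module
over `B` via `b ↦ b ⊗ 1`, and `B` acts on `N ⊗_B X` from the right via `b ↦ 1 ⊗ b`. -/
structure IsConnection (X : DGMod (envelope f)) (n : ℤ) (D : B →+ X)
    (ψ : N →+ tens f N X) : Prop where
  mem : ∀ i, ∀ x ∈ N.gr i, ψ x ∈ (tens f N X).gr (i + n)
  linear : ∀ (x : N) (a : A), ψ (x <• f a) = ψ x <• inr f (f a)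
  rule : ∀ i, ∀ x ∈ N.gr i, ∀ b : B,
    ψ (x <• b) = ψ x <• inr f b + sgn (n * i) • tm f N X x (D b)

/-- `g : N → N ⊗_B X` is right `B`-linear of degree `n`. -/
structure IsHom (X : DGMod (envelope f)) (n : ℤ) (g : N →+ tens f N X) : Prop where
  mem : ∀ i, ∀ x ∈ N.gr i, g x ∈ (tens f N X).gr (i + n)
  linear : ∀ (x : N) (b : B), g (x <• b) = g x <• inr f b

/-- The group of `A`-derivations `B → X` of degree `n`. -/
def derGroup (X : DGMod (envelope f)) (n : ℤ) : AddSubgroup (B →+ X) where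
  carrier := {D | IsDerivation f X n D}
  zero_mem' := by constructor <;> simp [zero_mem]
  add_mem' := by
    rintro D E hD hE
    refine ⟨fun i b hb => add_mem (hD.mem i b hb) (hE.mem i b hb), ?_, ?_⟩
    · intro b a
      simp [hD.linear, hE.linear]
    · intro i b hb c
      simp only [AddMonoidHom.add_apply, hD.leibniz i b hb, hE.leibniz i b hb, smul_add, map_add]
      abel
  neg_mem' := by
    rintro D hD
    refine ⟨fun i b hb => neg_mem (hD.mem i b hb), ?_, ?_⟩
    · intro b a
      simp [hD.linear]
    · intro i b hb c
      simp only [AddMonoidHom.neg_apply, hD.leibniz i b hb, smul_neg, map_neg]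
      abel

/-- The group of connections of degree `n` on `N` along `X`. Its elements are the pairs `(D, ψ)`
of a derivation `D` and a `D`-connection `ψ`. If `N` is nonzero and free as a graded module then
`D` is determined by `ψ`; if `N = 0` the pairs `(D, 0)` are distinguished from each other. -/
def connGroup (X : DGMod (envelope f)) (n : ℤ) :
    AddSubgroup ((B →+ X) × (N →+ tens f N X)) where
  carrier := {p | IsDerivation f X n p.1 ∧ IsConnection f N X n p.1 p.2}
  zero_mem' := by
    refine ⟨(derGroup f X n).zero_mem, ?_⟩
    constructor <;> simp [zero_mem]
  add_mem' := by
    rintro p q ⟨hp, hp'⟩ ⟨hq, hq'⟩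
    refine ⟨(derGroup f X n).add_mem hp hq,
      fun i x hx => add_mem (hp'.mem i x hx) (hq'.mem i x hx), ?_, ?_⟩
    · intro x a
      simp [hp'.linear, hq'.linear]
    · intro i x hx b
      simp only [Prod.snd_add, Prod.fst_add, AddMonoidHom.add_apply, hp'.rule i x hx,
        hq'.rule i x hx, smul_add, map_add]
      abel
  neg_mem' := by
    rintro p ⟨hp, hp'⟩
    refine ⟨(derGroup f X n).neg_mem hp, fun i x hx => neg_mem (hp'.mem i x hx), ?_, ?_⟩
    · intro x a
      simp [hp'.linear]
    · intro i x hx b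
      simp only [Prod.snd_neg, Prod.fst_neg, AddMonoidHom.neg_apply, hp'.rule i x hx,
        smul_neg, map_neg]
      abel

/-- The group of right `B`-linear maps `N → N ⊗_B X` of degree `n`. -/
def homGroup (X : DGMod (envelope f)) (n : ℤ) : AddSubgroup (N →+ tens f N X) where
  carrier := {g | IsHom f N X n g}
  zero_mem' := by constructor <;> simp [zero_mem]
  add_mem' := by
    rintro g h hg hh
    refine ⟨fun i x hx => add_mem (hg.mem i x hx) (hh.mem i x hx), ?_⟩
    intro x b
    simp [hg.linear, hh.linear]
  neg_mem' := by
    rintro g hg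
    refine ⟨fun i x hx => neg_mem (hg.mem i x hx), ?_⟩
    intro x b
    simp [hg.linear]

variable {f N}

lemma IsDerivation.act {X : DGMod (envelope f)} {i j : ℤ} {b : B} (hb : b ∈ B.gr i) {D : B →+ X}
    (hD : IsDerivation f X j D) : IsDerivation f X (i + j) (homAct X (inl f b) D) := by
  refine ⟨?_, ?_, ?_⟩
  · intro l c hc
    have := X.lsmul_mem ((inl f).mem hb) (hD.mem l c hc)
    rw [show l + (i + j) = i + (l + j) by ring]
    exact this
  · intro c a
    rw [homAct_apply, homAct_apply, hD.linear, X.lsmul_rsmul]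
  · intro l c hc e
    rw [homAct_apply, homAct_apply, homAct_apply, hD.leibniz l c hc, map_add, X.lsmul_rsmul,
      map_zsmul, ← X.lsmul_mul, ← X.lsmul_mul, ← map_mul, ← map_mul, B.gcomm _ _ b hb c hc,
      map_zsmul, map_zsmul, AddMonoidHom.smul_apply, smul_smul, ← sgn_add]
    congr 2
    exact sgn_congr ⟨0, by ring⟩

lemma IsDerivation.d {X : DGMod (envelope f)} {n : ℤ} {D : B →+ X}
    (hD : IsDerivation f X n D) :
    IsDerivation f X (n - 1) (homD X B.d.toAddMonoidHom n D) := by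
  refine ⟨?_, ?_, ?_⟩
  · intro i b hb
    refine sub_mem ?_ (zsmul_mem ?_ _)
    · have := X.d_mem _ _ (hD.mem i b hb)
      rwa [show i + (n - 1) = i + n - 1 by ring]
    · have := hD.mem _ _ (B.d_mem i b hb)
      rwa [show i + (n - 1) = i - 1 + n by ring]
  · intro b a
    refine B.ext_homog (f := (homD X B.d.toAddMonoidHom n D).comp (AddMonoidHom.mulRight (f a)))
      (g := (X.rmul (inr f (f a))).comp (homD X B.d.toAddMonoidHom n D)) ?_ b
    intro i b hb
    simp only [AddMonoidHom.comp_apply, AddMonoidHom.coe_mulRight, homD_apply,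
      LinearMap.toAddMonoidHom_coe, GrMod.rmul_apply]
    rw [hD.linear, X.leibniz _ _ (hD.mem i b hb), B.leibniz i b hb, ← f.d, ← (inr f).d, ← f.d,
      map_add, map_zsmul, hD.linear, hD.linear, smul_sub, smul_add, smul_smul, add_comm i n,
      sgn_add, smul_comm (MulOpposite.op _) (sgn n)]
    abel
  · intro i b hb c
    simp only [homD_apply, LinearMap.toAddMonoidHom_coe]
    rw [hD.leibniz i b hb, B.leibniz i b hb, map_add, map_add, map_zsmul, map_zsmul,
      X.leibniz _ _ (hD.mem i b hb), X.d_lsmul ((inl f).mem hb), hD.leibniz _ _ (B.d_mem i b hb),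
      hD.leibniz i b hb, ← (inr f).d, ← (inl f).d, map_sub, map_zsmul]
    simp only [smul_add, smul_sub, smul_smul]
    rw [smul_comm (MulOpposite.op _) (sgn n)]
    have e1 : sgn (i + n) = sgn n * sgn i := by rw [sgn_add, mul_comm]
    have e2 : sgn n * sgn (n * (i - 1)) = sgn (n * i) := by
      rw [← sgn_add]; exact sgn_congr ⟨0, by ring⟩
    have e3 : sgn ((n - 1) * i) = sgn (n * i) * sgn i := by
      rw [← sgn_add]; exact sgn_congr ⟨-i, by ring⟩
    have e4 : sgn ((n - 1) * i) * sgn n = sgn n * (sgn i * sgn (n * i)) := by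
      rw [e3]; ring
    rw [e1, e2, e4, e3]
    abel

lemma tens_d {X : DGMod (envelope f)} {i : ℤ} {x : N} (hx : x ∈ N.gr i) (y : X) :
    (tens f N X).d (tm f N X x y)
      = (tm f N X (N.d x) y + sgn i • tm f N X x (X.d y) :
          (tens f N X).carrier) :=
  tensorD_tmul (inl f) N X hx y

lemma tens_lsmul {X : DGMod (envelope f)} {i l : ℤ} {c : envelope f} {x : N}
    (hc : c ∈ (envelope f).gr i) (hx : x ∈ N.gr l) (y : X) :
    (tens f N X).lsmul c (tm f N X x y) = sgn (i * l) • tm f N X x (X.lsmul c y) :=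
  tensor_lsmul (inl f) N X hc hx y

lemma IsConnection.act {X : DGMod (envelope f)} {i j : ℤ} {b : B} (hb : b ∈ B.gr i) {D : B →+ X}
    {ψ : N →+ tens f N X} (h : IsConnection f N X j D ψ) :
    IsConnection f N X (i + j) (homAct X (inl f b) D)
      (homAct (tens f N X) (inl f b) ψ) := by
  refine ⟨?_, ?_, ?_⟩
  · intro l x hx
    have := (tens f N X).lsmul_mem ((inl f).mem hb) (h.mem l x hx)
    rw [show l + (i + j) = i + (l + j) by ring]
    exact this
  · intro x a
    rw [homAct_apply, homAct_apply, h.linear, (tens f N X).lsmul_rsmul]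
  · intro l x hx c
    rw [homAct_apply, homAct_apply, homAct_apply, h.rule l x hx, map_add,
      (tens f N X).lsmul_rsmul, map_zsmul]
    rw [tens_lsmul ((inl f).mem hb) hx (D c), smul_smul, ← sgn_add]
    congr 2
    exact sgn_congr ⟨0, by ring⟩

lemma IsConnection.d {X : DGMod (envelope f)} {n : ℤ} {D : B →+ X}
    {ψ : N →+ tens f N X} (h : IsConnection f N X n D ψ) :
    IsConnection f N X (n - 1) (homD X B.d.toAddMonoidHom n D)
      (homD (tens f N X) N.d n ψ) := by
  refine ⟨?_, ?_, ?_⟩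
  · intro i x hx
    refine sub_mem ?_ (zsmul_mem ?_ _)
    · have := (tens f N X).d_mem _ _ (h.mem i x hx)
      rwa [show i + (n - 1) = i + n - 1 by ring]
    · have := h.mem _ _ (N.d_mem i x hx)
      rwa [show i + (n - 1) = i - 1 + n by ring]
  · intro x a
    refine N.ext_homog (f := (homD (tens f N X) N.d n ψ).comp (N.rmul (f a)))
      (g := ((tens f N X).rmul (inr f (f a))).comp
        (homD (tens f N X) N.d n ψ)) ?_ x
    intro i x hx
    simp only [AddMonoidHom.comp_apply, homD_apply, GrMod.rmul_apply]
    rw [h.linear, (tens f N X).leibniz _ _ (h.mem i x hx), N.leibniz i x hx, ← f.d,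
      ← (inr f).d, ← f.d, map_add, map_zsmul, h.linear, h.linear, smul_sub, smul_add, smul_smul,
      add_comm i n, sgn_add, smul_comm (MulOpposite.op _) (sgn n)]
    abel
  · intro i x hx c
    simp only [homD_apply, LinearMap.toAddMonoidHom_coe]
    rw [h.rule i x hx, N.leibniz i x hx, map_add, map_add, map_zsmul, map_zsmul,
      (tens f N X).leibniz _ _ (h.mem i x hx), tens_d hx, h.rule _ _ (N.d_mem i x hx),
      h.rule i x hx, ← (inr f).d, map_sub, map_zsmul]
    simp only [smul_add, smul_sub, smul_smul]
    rw [smul_comm (MulOpposite.op _) (sgn n)]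
    have e1 : sgn (i + n) = sgn n * sgn i := by rw [sgn_add, mul_comm]
    have e2 : sgn n * sgn (n * (i - 1)) = sgn (n * i) := by
      rw [← sgn_add]; exact sgn_congr ⟨0, by ring⟩
    have e3 : sgn ((n - 1) * i) = sgn (n * i) * sgn i := by
      rw [← sgn_add]; exact sgn_congr ⟨-i, by ring⟩
    have e4 : sgn ((n - 1) * i) * sgn n = sgn n * (sgn i * sgn (n * i)) := by
      rw [e3]; ring
    rw [e1, e2, e4, e3]
    abel

lemma isHom_iff {X : DGMod (envelope f)} {n : ℤ} {g : N →+ tens f N X} :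
    IsHom f N X n g ↔ IsConnection f N X n 0 g := by
  constructor
  · intro h
    exact ⟨h.mem, fun x a => h.linear x (f a), fun i x _ b => by simp [h.linear x b]⟩
  · intro h
    refine ⟨h.mem, fun x b => ?_⟩
    refine N.ext_homog (f := g.comp (N.rmul b))
      (g := ((tens f N X).rmul (inr f b)).comp g) ?_ x
    intro i x hx
    have := h.rule i x hx b
    simpa using this

variable (f N)

/-- The left action of `B` on additive maps with values in a module over `B ⊗_A B`, given by
`(b g) (x) = (b ⊗ 1) (g x)`. -/
def bAct {P : Type u} [AddCommGroup P] (Y : DGMod (envelope f)) : B →+ (P →+ Y) →+ (P →+ Y) :=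
  (homAct Y).comp ((inl f).toAlgHom : B →+ envelope f)

lemma bAct_apply {P : Type u} [AddCommGroup P] (Y : DGMod (envelope f)) (b : B) (g : P →+ Y) :
    bAct f Y b g = homAct Y (inl f b) g := rfl

/-- The left action of `B` on pairs `(D, ψ)`. -/
def connAct (X : DGMod (envelope f)) :
    B →+ (B →+ X) × (N →+ tens f N X) →+ (B →+ X) × (N →+ tens f N X) :=
  AddMonoidHom.mk' (fun b => (bAct f X b).prodMap (bAct f (tens f N X) b)) (by
    intro b c
    refine AddMonoidHom.ext fun p => ?_
    refine Prod.ext ?_ ?_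
    · exact DFunLike.congr_fun (map_add (bAct f X) b c) p.1
    · exact DFunLike.congr_fun (map_add (bAct f (tens f N X)) b c) p.2)

/-- The differential on pairs `(D, ψ)` of degree `n`. -/
def connD (X : DGMod (envelope f)) (n : ℤ) :
    (B →+ X) × (N →+ tens f N X) →+ (B →+ X) × (N →+ tens f N X) :=
  (homD X B.d.toAddMonoidHom n).prodMap (homD (tens f N X) N.d n)

lemma bAct_one {P : Type u} [AddCommGroup P] (Y : DGMod (envelope f)) (g : P →+ Y) :
    bAct f Y 1 g = g := by
  rw [bAct_apply, map_one]
  exact homAct_one Y g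

lemma bAct_mul {P : Type u} [AddCommGroup P] (Y : DGMod (envelope f)) (a b : B) (g : P →+ Y) :
    bAct f Y (a * b) g = bAct f Y a (bAct f Y b g) := by
  simp only [bAct_apply]
  rw [map_mul]
  exact homAct_mul Y _ _ g

lemma homD_bAct {P : Type u} [AddCommGroup P] (Y : DGMod (envelope f)) (dP : P →+ P) (i j : ℤ)
    (b : B) (hb : b ∈ B.gr i) (g : P →+ Y) :
    homD Y dP (i + j) (bAct f Y b g)
      = bAct f Y (B.d b) g + sgn i • bAct f Y b (homD Y dP j g) := by
  simp only [bAct_apply]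
  rw [homD_homAct Y _ j ((inl f).mem hb), ← (inl f).d]

/-- The left DG module `*Der_A(B, X)` over `B`. -/
def derMod (X : DGMod (envelope f)) : LeftDGMod B :=
  LeftDGMod.ofFamily (bAct f X) (homD X B.d.toAddMonoidHom) (derGroup f X)
    (bAct_one f X) (bAct_mul f X) (homD_homD X _ B.d_d) (homD_bAct f X _)
    (fun _ _ _ hb _ hD => IsDerivation.act hb hD) (fun _ _ hD => IsDerivation.d hD)

/-- The left DG module `*Conn(N, N ⊗_B X)` over `B`. -/
def connMod (X : DGMod (envelope f)) : LeftDGMod B :=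
  LeftDGMod.ofFamily (connAct f N X) (connD f N X) (connGroup f N X)
    (fun p => Prod.ext (bAct_one f X p.1) (bAct_one f (tens f N X) p.2))
    (fun a b p => Prod.ext (bAct_mul f X a b p.1) (bAct_mul f (tens f N X) a b p.2))
    (fun n p => Prod.ext (homD_homD X _ B.d_d n p.1) (homD_homD (tens f N X) _ N.d_d n p.2))
    (fun i j b hb p =>
      Prod.ext (homD_bAct f X _ i j b hb p.1) (homD_bAct f (tens f N X) _ i j b hb p.2))
    (fun _ _ _ hb _ hp => ⟨IsDerivation.act hb hp.1, IsConnection.act hb hp.2⟩)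
    (fun _ _ hp => ⟨IsDerivation.d hp.1, IsConnection.d hp.2⟩)

/-- The left DG module `*Hom_B(N, N ⊗_B X)` over `B`. -/
def homMod (X : DGMod (envelope f)) : LeftDGMod B :=
  LeftDGMod.ofFamily (bAct f (tens f N X)) (homD (tens f N X) N.d)
    (homGroup f N X)
    (bAct_one f _) (bAct_mul f _) (homD_homD _ _ N.d_d) (homD_bAct f _ _)
    (by
      intro i j b hb g hg
      refine isHom_iff.2 ?_
      have := IsConnection.act hb (isHom_iff.1 hg)
      rwa [map_zero] at this)
    (by
      intro n g hg
      refine isHom_iff.2 ?_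
      have := IsConnection.d (isHom_iff.1 hg)
      rwa [map_zero] at this)

/-- The inclusion `ι : *Hom_B(N, N ⊗_B X) → *Conn(N, N ⊗_B X)` of the `0`-connections. -/
def iota (X : DGMod (envelope f)) : LeftDGHom (homMod f N X) (connMod f N X) where
  app n := AddMonoidHom.mk'
    (fun g => (⟨(0, g.1), (derGroup f X n).zero_mem, isHom_iff.1 g.2⟩ : connGroup f N X n))
    (by intro g h; exact Subtype.ext (Prod.ext (add_zero 0).symm rfl))
  map_smul _ b _ := Subtype.ext (Prod.ext (map_zero (bAct f X b)).symm rfl)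
  map_d n _ := Subtype.ext (Prod.ext (map_zero (homD X B.d.toAddMonoidHom n)).symm rfl)

/-- The map `ν : *Conn(N, N ⊗_B X) → *Der_A(B, X)` sending a `D`-connection to `D`. -/
def nu (X : DGMod (envelope f)) : LeftDGHom (connMod f N X) (derMod f X) where
  app n := AddMonoidHom.mk' (fun p => (⟨p.1.1, p.2.1⟩ : derGroup f X n)) (by intro p q; rfl)
  map_smul _ _ _ := rfl
  map_d _ _ := rfl

/-- The fundamental exact sequence
`0 → *Hom_B(N, N ⊗_B X) → *Conn(N, N ⊗_B X) → *Der_A(B, X) → 0` of connections on `N` along `X`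
splits as a sequence of left DG modules over `B`. -/
def FundamentalSplits (X : DGMod (envelope f)) : Prop := Splits (iota f N X) (nu f N X)

/-- `N` admits a `*Der_A(B, X)`-connection: a homomorphism of left DG modules
`∇ : *Der_A(B, X) → *Conn(N, N ⊗_B X)` such that `∇_D` is a `D`-connection for every `D`. -/
def AdmitsDerConnection (X : DGMod (envelope f)) : Prop :=
  ∃ nabla : LeftDGHom (derMod f X) (connMod f N X),
    ∀ n (D : (derMod f X).comp n), (nu f N X).app n (nabla.app n D) = D

lemma isDerivation_deltaHom : IsDerivation f (diag f) 0 (deltaHom f) := by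
  refine ⟨?_, ?_, ?_⟩
  · intro i b hb
    rw [add_zero, diagVal_mem, diagVal_delta]
    exact sub_mem ((inl f).mem hb) ((inr f).mem hb)
  · intro b a
    apply diagVal_injective
    rw [diagVal_rsmul, diagVal_delta, diagVal_delta, map_mul, map_mul, sub_mul, inl_eq_inr]
  · intro i b _ c
    apply diagVal_injective
    rw [zero_mul, sgn_zero, one_smul, map_add, diagVal_rsmul, diagVal_lsmul, diagVal_delta,
      diagVal_delta, diagVal_delta, map_mul, map_mul, sub_mul, mul_sub]
    abel

/-- The universal derivation `δ`, as an element of degree `0` of `*Der_A(B, J)`. -/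
def delta : (derMod f (diag f)).comp 0 :=
  (⟨deltaHom f, isDerivation_deltaHom f⟩ : derGroup f (diag f) 0)

end Connections

end

end NaiveLifting

/-!
Write `μ : B ⊗_A B → B` for the multiplication. The equivalences rest on three facts.

*Splitting means having a section of `ν`.* If `s` is a section of `ν` and `ψ` is a `D`-connection,
then `ψ - s D` is a connection along the zero derivation, that is, a `B`-linear map; this gives the
retraction of `ι` (`fundamentalSplits_iff`). So the sequence along `X` splits exactly if `N` admits
a connection along `X`.

*A cyclic `δ`-connection determines connections along every derivation.* A derivation
`D : B → X` factors as `D = h_D ∘ δ`, where `h_D` is the restriction to `J` of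
`b ⊗ c ↦ D(b) c` (`IsDerivation.lift`). On `B ⊗_A B` this map is linear on the right, and it fails
to be linear on the left by the term `D(b) μ(t)` (`IsDerivation.lift_inl_mul`), so that `h_D` is
linear on both sides up to sign. Hence `1 ⊗ h_D : N ⊗_B J → N ⊗_B X` exists, and for a
`δ`-connection `ψ` the composite `(1 ⊗ h_D) ∘ ψ` is a `D`-connection. It depends `B`-linearly on `D`,
and it commutes with the differentials if `ψ` is a cycle (`admitsDerConnection_of_cycle`).
Conversely, `δ` is a cycle, so the value at `δ` of a connection along `J` is a `δ`-connection that is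
a cycle. Hence a connection along `J` already gives connections along every module.

*Cyclic `δ`-connections are sections of `π_N`.* The inclusion `J → B ⊗_A B` has the left `B`-linear
retraction `t ↦ t - μ(t) ⊗ 1`, so that `N ⊗_B J` embeds into `N ⊗_B (B ⊗_A B) = N ⊗_A B`
(`diagToBaseChange_injective`), and the image is the kernel of `π_N`
(`piHom_diagToBaseChange`, `diagToBaseChange_baseChangeToDiag`). A map `s : N → N ⊗_A B` with
`π_N s = 1` therefore amounts to the map `ψ(x) = x ⊗ 1 - s(x)` into `N ⊗_B J`. Since
`x b ⊗ 1 - x ⊗ b` is the image of `x ⊗ δ b`, the map `s` is `B`-linear exactly if `ψ` is a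
`δ`-connection, and it is a chain map exactly if `ψ` is a cycle
(`naivelyLiftable_iff_exists_cycle`).
-/

namespace NaiveLifting

noncomputable section

open scoped RightActions

variable {R : Type u} [CommRing R] {A B : DGAlg R} (f : DGAlgHom A B) (N : DGMod B)

/-! ### The tensor product of `N` and a module over the enveloping algebra -/

section Tens

variable {f N} {X Y : DGMod (envelope f)}

lemma tens_ext {P : Type*} [AddCommGroup P] {g h : tens f N X →+ P}
    (H : ∀ i, ∀ x ∈ N.gr i, ∀ j, ∀ y ∈ X.gr j, g (tm f N X x y) = h (tm f N X x y))
    (t : tens f N X) : g t = h t :=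
  tensor_ext (inl f) H t

lemma tm_smul (x : N) (b : B) (y : X) :
    tm f N X (x <• b) y = tm f N X x (X.lsmul (inl f b) y) :=
  tmul_smul (inl f) N X x b y

lemma tm_rsmul (x : N) (y : X) (c : envelope f) : tm f N X x y <• c = tm f N X x (y <• c) :=
  tmul_rsmul (inl f) N X c x y

lemma tm_mem {i j k : ℤ} (h : i + j = k) {x : N} {y : X} (hx : x ∈ N.gr i) (hy : y ∈ X.gr j) :
    tm f N X x y ∈ (tens f N X).gr k :=
  tmul_mem (inl f) h hx hy

lemma map_mem_of_tm {P : Type*} [AddCommGroup P] {g : tens f N X →+ P} {S : AddSubgroup P} {k : ℤ}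
    (H : ∀ i j, i + j = k → ∀ x ∈ N.gr i, ∀ y ∈ X.gr j, g (tm f N X x y) ∈ S)
    {t : tens f N X} (ht : t ∈ (tens f N X).gr k) : g t ∈ S := by
  change t ∈ AddSubgroup.closure _ at ht
  suffices h : tensorGr (inl f) N X k ≤ S.comap g from h ht
  refine (AddSubgroup.closure_le _).2 ?_
  rintro _ ⟨i, j, h, x, hx, y, hy, rfl⟩
  exact H i j h x hx y hy

variable (N) in
/-- The map `1 ⊗ h : N ⊗_B X → N ⊗_B Y`, `x ⊗ y ↦ (-1) ^ (n |x|) x ⊗ h y`, for a map `h : X → Y` of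
degree `n` that is `B`-linear on the left up to the sign `(-1) ^ (n |b|)`. -/
def tensMap (n : ℤ) (h : X →+ Y)
    (hl : ∀ i, ∀ b ∈ B.gr i, ∀ y,
      h (X.lsmul (inl f b) y) = sgn (n * i) • Y.lsmul (inl f b) (h y)) :
    tens f N X →+ tens f N Y :=
  tlift (inl f) (((tm f N Y).comp (N.twist n)).compl₂ h) (by
    intro i x hx j b hb k y _
    simp only [AddMonoidHom.compl₂_apply, AddMonoidHom.comp_apply]
    rw [N.twist_apply n hx, N.twist_apply n (N.smul_mem' hx hb), hl j b hb]
    simp only [map_zsmul, AddMonoidHom.smul_apply, tm_smul, smul_smul]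
    rw [mul_add, sgn_add, mul_comm (sgn (n * j))])

lemma tensMap_tm {n : ℤ} {h : X →+ Y} (hl) {i : ℤ} {x : N} (hx : x ∈ N.gr i) (y : X) :
    tensMap N n h hl (tm f N X x y) = sgn (n * i) • tm f N Y x (h y) := by
  refine (tlift_tmul (inl f) _ _ x y).trans ?_
  simp only [AddMonoidHom.compl₂_apply, AddMonoidHom.comp_apply]
  rw [N.twist_apply n hx, map_zsmul, AddMonoidHom.smul_apply]

lemma tensMap_mem {n : ℤ} {h : X →+ Y} (hl) (hm : ∀ i, ∀ y ∈ X.gr i, h y ∈ Y.gr (i + n)) {k : ℤ}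
    {t : tens f N X} (ht : t ∈ (tens f N X).gr k) :
    tensMap N n h hl t ∈ (tens f N Y).gr (k + n) := by
  refine map_mem_of_tm ?_ ht
  intro i j hij x hx y hy
  rw [tensMap_tm hl hx]
  exact zsmul_mem (tm_mem (by omega) hx (hm j y hy)) _

lemma tensMap_rsmul {n : ℤ} {h : X →+ Y} (hl) (c : envelope f)
    (hr : ∀ y, h (y <• c) = h y <• c) (t : tens f N X) :
    tensMap N n h hl (t <• c) = tensMap N n h hl t <• c := by
  refine tens_ext (g := (tensMap N n h hl).comp ((tens f N X).rmul c))
    (h := ((tens f N Y).rmul c).comp (tensMap N n h hl)) ?_ t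
  intro i x hx j y _
  simp only [AddMonoidHom.comp_apply, GrMod.rmul_apply]
  rw [tm_rsmul, tensMap_tm hl hx, tensMap_tm hl hx, hr, smul_comm (MulOpposite.op c), tm_rsmul]

/-- The differential of `1 ⊗ h` is `1 ⊗ h'`, where `h'` is the differential of `h`. -/
lemma tensMap_d {n : ℤ} {h h' : X →+ Y} (hl hl')
    (hd : ∀ y, h' y = Y.d (h y) - sgn n • h (X.d y)) (t : tens f N X) :
    tensMap N (n - 1) h' hl' t
      = (tens f N Y).d (tensMap N n h hl t) - sgn n • tensMap N n h hl ((tens f N X).d t) := by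
  refine tens_ext (g := tensMap N (n - 1) h' hl') (h := (tens f N Y).d.comp (tensMap N n h hl)
    - sgn n • (tensMap N n h hl).comp (tens f N X).d) ?_ t
  intro i x hx j y _
  simp only [AddMonoidHom.comp_apply, AddMonoidHom.sub_apply, AddMonoidHom.smul_apply]
  rw [tensMap_tm hl hx, tensMap_tm hl' hx, tens_d hx, map_add, map_zsmul, map_zsmul, tens_d hx,
    tensMap_tm hl hx, tensMap_tm hl (N.d_mem i x hx), hd, map_sub, map_zsmul]
  simp only [smul_add, smul_sub, smul_smul]
  have e1 : sgn ((n - 1) * i) = sgn (n * i) * sgn i := by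
    rw [← sgn_add]; exact sgn_congr ⟨-i, by ring⟩
  have e2 : sgn n * sgn (n * (i - 1)) = sgn (n * i) := by
    rw [← sgn_add]; exact sgn_congr ⟨0, by ring⟩
  rw [e1, e2, show sgn (n * i) * sgn i * sgn n = sgn n * (sgn i * sgn (n * i)) by ring]
  abel

end Tens

/-! ### Pure tensors in the enveloping algebra -/

section PureTensors

/-- The pure tensor `b ⊗ c` as an element of the enveloping DG algebra. -/
def envTmul : B →+ B →+ envelope f := et f

variable {f}

lemma inl_eq_envTmul (b : B) : inl f b = envTmul f b 1 := rfl

lemma inr_eq_envTmul (b : B) : inr f b = envTmul f 1 b := rfl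

lemma mult_envTmul (b c : B) : mult f (envTmul f b c) = b * c := rfl

lemma envTmul_mul_inr (b c e : B) : envTmul f b c * inr f e = envTmul f b (c * e) := by
  refine B.ext_homog (f := (AddMonoidHom.mulRight (inr f e)).comp (envTmul f b))
    (g := (envTmul f b).comp (AddMonoidHom.mulRight e)) ?_ c
  intro i c hc
  refine (et_mul_et f b hc B.one_mem e).trans ?_
  rw [mul_zero, sgn_zero, one_smul, mul_one]
  rfl

lemma inl_mul_envTmul (b c e : B) : inl f b * envTmul f c e = envTmul f (b * c) e := by
  refine (et_mul f b 1 (et f c e)).trans ?_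
  rw [envR_one, envL_et]
  rfl

lemma envTmul_d {i : ℤ} {b : B} (hb : b ∈ B.gr i) (c : B) :
    (envelope f).d (envTmul f b c) = envTmul f (B.d b) c + sgn i • envTmul f b (B.d c) :=
  et_d f hb c

lemma envelope_ext {P : Type*} [AddCommGroup P] {g h : envelope f →+ P}
    (H : ∀ i, ∀ b ∈ B.gr i, ∀ c, g (envTmul f b c) = h (envTmul f b c)) (t : envelope f) :
    g t = h t :=
  env_ext f (fun i b hb _ c _ => H i b hb c) t

lemma map_mem_of_envTmul {P : Type*} [AddCommGroup P] {g : envelope f →+ P} {S : AddSubgroup P}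
    {k : ℤ} (H : ∀ i j, i + j = k → ∀ b ∈ B.gr i, ∀ c ∈ B.gr j, g (envTmul f b c) ∈ S)
    {t : envelope f} (ht : t ∈ (envelope f).gr k) : g t ∈ S := by
  change t ∈ AddSubgroup.closure _ at ht
  induction ht using AddSubgroup.closure_induction with
  | mem t ht =>
    obtain ⟨i, j, h, b, hb, c, hc, rfl⟩ := ht
    exact H i j h b hb c hc
  | zero => exact (map_zero g).symm ▸ zero_mem _
  | add u v _ _ hu hv => exact (map_add g u v).symm ▸ add_mem hu hv
  | neg u _ hu => exact (map_neg g u).symm ▸ neg_mem hu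

end PureTensors

/-! ### The linear map induced by a derivation -/

section Universal

variable {f} {X : DGMod (envelope f)} {n : ℤ} {D : B →+ X}

/-- The map `B ⊗_A B → X`, `b ⊗ c ↦ D(b) c`, attached to a derivation `D`. Its restriction to `J` is
the linear map through which `D` factors along the universal derivation. -/
def IsDerivation.lift (hD : IsDerivation f X n D) : envelope f →+ X :=
  envLift f (((X.rmul.comp ((inr f).toAlgHom : B →+ envelope f)).flip).comp D) (by
    intro i b _ j a _ k c _
    change D (b * f a) <• inr f c = D b <• inr f (f a * c)
    rw [hD.linear, map_mul, op_smul_op_smul])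

lemma IsDerivation.lift_envTmul (hD : IsDerivation f X n D) (b c : B) :
    hD.lift (envTmul f b c) = D b <• inr f c := rfl

lemma IsDerivation.lift_mem (hD : IsDerivation f X n D) {k : ℤ} {t : envelope f}
    (ht : t ∈ (envelope f).gr k) : hD.lift t ∈ X.gr (k + n) := by
  refine map_mem_of_envTmul ?_ ht
  intro i j h b hb c hc
  have := X.smul_mem' (hD.mem i b hb) ((inr f).mem hc)
  rw [show i + n + j = k + n by omega] at this
  exact this

lemma IsDerivation.lift_mul_inr (hD : IsDerivation f X n D) (t : envelope f) (c : B) :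
    hD.lift (t * inr f c) = hD.lift t <• inr f c := by
  refine envelope_ext (g := hD.lift.comp (AddMonoidHom.mulRight (inr f c)))
    (h := (X.rmul (inr f c)).comp hD.lift) ?_ t
  intro i b _ e
  change hD.lift (envTmul f b e * inr f c) = hD.lift (envTmul f b e) <• inr f c
  rw [envTmul_mul_inr, lift_envTmul, lift_envTmul, map_mul, ← op_smul_op_smul]

/-- The failure of `b ⊗ c ↦ D(b) c` to be linear on the left; it vanishes on `J`. -/
lemma IsDerivation.lift_inl_mul (hD : IsDerivation f X n D) {i : ℤ} {b : B} (hb : b ∈ B.gr i)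
    (t : envelope f) : hD.lift (inl f b * t)
      = D b <• inr f (mult f t) + sgn (n * i) • X.lsmul (inl f b) (hD.lift t) := by
  refine envelope_ext (g := hD.lift.comp (AddMonoidHom.mulLeft (inl f b)))
    (h := (X.rmul.flip (D b)).comp
        (((inr f).toAlgHom : B →+ envelope f).comp ((mult f).toAlgHom : envelope f →+ B))
      + sgn (n * i) • (X.lsmul (inl f b)).comp hD.lift) ?_ t
  intro j c _ e
  change hD.lift (inl f b * envTmul f c e) = D b <• inr f (c * e)
    + sgn (n * i) • X.lsmul (inl f b) (hD.lift (envTmul f c e))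
  rw [inl_mul_envTmul, lift_envTmul, lift_envTmul, hD.leibniz i b hb, smul_add, map_mul,
    ← op_smul_op_smul, smul_comm (MulOpposite.op _) (sgn _), X.lsmul_rsmul]

lemma IsDerivation.lift_d (hD : IsDerivation f X n D) (t : envelope f) :
    hD.d.lift t = X.d (hD.lift t) - sgn n • hD.lift ((envelope f).d t) := by
  refine envelope_ext (g := hD.d.lift)
    (h := X.d.comp hD.lift - sgn n • hD.lift.comp (envelope f).d.toAddMonoidHom) ?_ t
  intro i b hb c
  simp only [AddMonoidHom.comp_apply, AddMonoidHom.sub_apply, AddMonoidHom.smul_apply,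
    LinearMap.toAddMonoidHom_coe]
  rw [envTmul_d hb, map_add, map_zsmul, lift_envTmul, lift_envTmul, lift_envTmul, lift_envTmul,
    X.leibniz _ _ (hD.mem i b hb), homD_apply, smul_sub, smul_comm (MulOpposite.op _) (sgn n),
    add_comm i n, sgn_add, ← (inr f).d, smul_add, smul_smul]
  simp only [LinearMap.toAddMonoidHom_coe]
  abel

/-- The restriction of `b ⊗ c ↦ D(b) c` to `J`. -/
def IsDerivation.liftDiag (hD : IsDerivation f X n D) : diag f →+ X := hD.lift.comp (diagVal f)

lemma IsDerivation.liftDiag_delta (hD : IsDerivation f X n D) (b : B) :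
    hD.liftDiag (deltaHom f b) = D b := by
  have h1 : D 1 = 0 := by
    have := hD.leibniz 0 1 B.one_mem 1
    rw [map_one (inr f).toAlgHom, map_one (inl f).toAlgHom, X.lsmul_one] at this
    simpa using this
  change hD.lift (diagVal f (deltaHom f b)) = D b
  rw [diagVal_delta, map_sub, inl_eq_envTmul, inr_eq_envTmul, lift_envTmul, lift_envTmul, h1,
    map_one]
  simp

lemma IsDerivation.liftDiag_lsmul (hD : IsDerivation f X n D) (i : ℤ) (b : B) (hb : b ∈ B.gr i)
    (y : diag f) : hD.liftDiag ((diag f).lsmul (inl f b) y)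
      = sgn (n * i) • X.lsmul (inl f b) (hD.liftDiag y) := by
  change hD.lift (diagVal f _) = sgn (n * i) • X.lsmul (inl f b) (hD.lift (diagVal f y))
  have hy : mult f (diagVal f y) = 0 := y.2
  rw [diagVal_lsmul, hD.lift_inl_mul hb, hy, map_zero]
  simp

end Universal

/-! ### Connections induced by a `δ`-connection -/

section Nabla

variable {f N} {X : DGMod (envelope f)} {n : ℤ} {D : B →+ X} {ψ : N →+ tens f N (diag f)}

/-- The composite of a `δ`-connection with `1 ⊗ h_D`, where `D = h_D ∘ δ`. -/
def inducedConn (ψ : N →+ tens f N (diag f)) (hD : IsDerivation f X n D) : N →+ tens f N X :=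
  (tensMap N n hD.liftDiag hD.liftDiag_lsmul).comp ψ

lemma isConnection_inducedConn (hψ : IsConnection f N (diag f) 0 (deltaHom f) ψ)
    (hD : IsDerivation f X n D) : IsConnection f N X n D (inducedConn ψ hD) := by
  have hr : ∀ b y, hD.liftDiag (y <• inr f b) = hD.liftDiag y <• inr f b := fun b y =>
    hD.lift_mul_inr (diagVal f y) b
  refine ⟨?_, ?_, ?_⟩
  · intro i x hx
    refine tensMap_mem hD.liftDiag_lsmul (fun _ _ hy => hD.lift_mem hy) ?_
    simpa using hψ.mem i x hx
  · intro x a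
    rw [inducedConn, AddMonoidHom.comp_apply, hψ.linear]
    exact tensMap_rsmul hD.liftDiag_lsmul _ (hr _) _
  · intro i x hx b
    rw [inducedConn, AddMonoidHom.comp_apply, AddMonoidHom.comp_apply, hψ.rule i x hx, map_add,
      tensMap_rsmul hD.liftDiag_lsmul _ (hr b), map_zsmul, tensMap_tm hD.liftDiag_lsmul hx,
      hD.liftDiag_delta, zero_mul, sgn_zero, one_smul]

lemma inducedConn_add {E : B →+ X} (hD : IsDerivation f X n D) (hE : IsDerivation f X n E)
    (hDE : IsDerivation f X n (D + E)) :
    inducedConn ψ hDE = inducedConn ψ hD + inducedConn ψ hE := by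
  have key : ∀ t, hDE.lift t = hD.lift t + hE.lift t := by
    refine envelope_ext (g := hDE.lift) (h := hD.lift + hE.lift) ?_
    intro i b _ c
    rw [AddMonoidHom.add_apply, hDE.lift_envTmul, hD.lift_envTmul, hE.lift_envTmul,
      AddMonoidHom.add_apply, smul_add]
  ext z
  refine tens_ext (g := tensMap N n hDE.liftDiag hDE.liftDiag_lsmul)
    (h := tensMap N n hD.liftDiag hD.liftDiag_lsmul
      + tensMap N n hE.liftDiag hE.liftDiag_lsmul) ?_ (ψ z)
  intro i x hx j y _
  rw [AddMonoidHom.add_apply, tensMap_tm _ hx, tensMap_tm _ hx, tensMap_tm _ hx, ← smul_add,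
    ← map_add]
  congr 2
  exact key (diagVal f y)

lemma inducedConn_act {i : ℤ} {b : B} (hb : b ∈ B.gr i) (hD : IsDerivation f X n D)
    (hbD : IsDerivation f X (i + n) (bAct f X b D)) :
    inducedConn ψ hbD = bAct f (tens f N X) b (inducedConn ψ hD) := by
  have key : ∀ t, hbD.lift t = X.lsmul (inl f b) (hD.lift t) := by
    refine envelope_ext (g := hbD.lift) (h := (X.lsmul (inl f b)).comp hD.lift) ?_
    intro j c _ e
    rw [AddMonoidHom.comp_apply, hbD.lift_envTmul, hD.lift_envTmul, X.lsmul_rsmul]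
    rfl
  ext z
  refine tens_ext (g := tensMap N (i + n) hbD.liftDiag hbD.liftDiag_lsmul)
    (h := ((tens f N X).lsmul (inl f b)).comp
      (tensMap N n hD.liftDiag hD.liftDiag_lsmul)) ?_ (ψ z)
  intro j x hx k y _
  rw [AddMonoidHom.comp_apply, tensMap_tm _ hx, tensMap_tm _ hx, map_zsmul,
    tens_lsmul ((inl f).mem hb) hx, smul_smul, ← sgn_add, add_mul, add_comm]
  congr 2
  exact key (diagVal f y)

/-- As `ψ` is a cycle, `D ↦ (1 ⊗ h_D) ∘ ψ` commutes with the differentials. -/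
lemma inducedConn_d (hψd : homD (tens f N (diag f)) N.d 0 ψ = 0) (hD : IsDerivation f X n D) :
    inducedConn ψ hD.d = homD (tens f N X) N.d n (inducedConn ψ hD) := by
  ext x
  have hx : (tens f N (diag f)).d (ψ x) = ψ (N.d x) := by
    have := DFunLike.congr_fun hψd x
    rw [homD_apply, sgn_zero, one_smul] at this
    exact sub_eq_zero.1 this
  have := tensMap_d (N := N) hD.liftDiag_lsmul hD.d.liftDiag_lsmul
    (fun y => hD.lift_d (diagVal f y)) (ψ x)
  rw [hx] at this
  exact this

/-- A `δ`-connection that is a cycle yields a connection `D ↦ (1 ⊗ h_D) ∘ ψ` along every module. -/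
lemma admitsDerConnection_of_cycle (hψ : IsConnection f N (diag f) 0 (deltaHom f) ψ)
    (hψd : homD (tens f N (diag f)) N.d 0 ψ = 0) (X : DGMod (envelope f)) :
    AdmitsDerConnection f N X := by
  let F : ∀ n, derGroup f X n →+ connGroup f N X n := fun n => AddMonoidHom.mk'
    (fun D => ⟨(D.1, inducedConn ψ D.2), D.2, isConnection_inducedConn hψ D.2⟩)
    (fun D E => Subtype.ext (Prod.ext rfl (inducedConn_add D.2 E.2 (D + E).2)))
  refine ⟨⟨F, ?_, ?_⟩, fun n D => rfl⟩
  · rintro i j _ rfl b D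
    exact Subtype.ext (Prod.ext rfl (inducedConn_act b.2 D.2 _))
  · intro n D
    exact Subtype.ext (Prod.ext rfl (inducedConn_d hψd D.2))

lemma homD_deltaHom : homD (diag f) B.d.toAddMonoidHom 0 (deltaHom f) = 0 := by
  ext b
  rw [homD_apply, sgn_zero, one_smul, AddMonoidHom.zero_apply, sub_eq_zero]
  apply diagVal_injective
  change (envelope f).d (inl f b - inr f b) = inl f (B.d b) - inr f (B.d b)
  rw [map_sub, (inl f).d, (inr f).d]

end Nabla

/-! ### Sections of `π_N` and `δ`-connections -/

section Lifting

/-- The DG module `N ⊗_A B` over `B`. -/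
abbrev baseChange : DGMod B := tensor f (DGMod.restrict f N) (DGMod.self B)

/-- The pure tensor `x ⊗ b` in `N ⊗_A B`, as a biadditive map. -/
def bt : N →+ B →+ baseChange f N := tmul f (DGMod.restrict f N) (DGMod.self B)

variable {f N}

lemma bt_smul (x : N) (a : A) (b : B) : bt f N (x <• f a) b = bt f N x (f a * b) :=
  (tmul_smul f (DGMod.restrict f N) (DGMod.self B) x a b).trans
    (congrArg (bt f N x) (DGMod.self_lsmul B (f a) b))

lemma bt_rsmul (x : N) (b c : B) : bt f N x b <• c = bt f N x (b * c) := rfl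

lemma bt_mem {i j k : ℤ} (h : i + j = k) {x : N} {b : B} (hx : x ∈ N.gr i) (hb : b ∈ B.gr j) :
    bt f N x b ∈ (baseChange f N).gr k :=
  tmul_mem (N := DGMod.restrict f N) (X := DGMod.self B) f h hx hb

lemma bt_d {i : ℤ} {x : N} (hx : x ∈ N.gr i) (b : B) :
    (baseChange f N).d (bt f N x b) = (bt f N (N.d x) b + sgn i • bt f N x (B.d b) :
      (baseChange f N).carrier) :=
  tensorD_tmul f (DGMod.restrict f N) (DGMod.self B) hx b

lemma baseChange_ext {P : Type*} [AddCommGroup P] {g h : baseChange f N →+ P}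
    (H : ∀ i, ∀ x ∈ N.gr i, ∀ b, g (bt f N x b) = h (bt f N x b)) (t : baseChange f N) :
    g t = h t :=
  tensor_ext (N := DGMod.restrict f N) (X := DGMod.self B) f (fun i x hx _ b _ => H i x hx b) t

lemma map_mem_of_bt {P : Type*} [AddCommGroup P] {g : baseChange f N →+ P} {S : AddSubgroup P}
    {k : ℤ} (H : ∀ i j, i + j = k → ∀ x ∈ N.gr i, ∀ b ∈ B.gr j, g (bt f N x b) ∈ S)
    {t : baseChange f N} (ht : t ∈ (baseChange f N).gr k) : g t ∈ S := by
  change t ∈ AddSubgroup.closure _ at ht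
  induction ht using AddSubgroup.closure_induction with
  | mem t ht =>
    obtain ⟨i, j, h, x, hx, b, hb, rfl⟩ := ht
    exact H i j h x hx b hb
  | zero => exact (map_zero g).symm ▸ zero_mem _
  | add u v _ _ hu hv => exact (map_add g u v).symm ▸ add_mem hu hv
  | neg u _ hu => exact (map_neg g u).symm ▸ neg_mem hu

lemma piHom_bt (x : N) (b : B) : piHom f N (bt f N x b) = x <• b := rfl

variable (f N) in
/-- The map `N → Hom(B ⊗_A B, N ⊗_A B)` sending `x` to `b ⊗ c ↦ x b ⊗ c`. -/
def envToBaseChange : N →+ envelope f →+ baseChange f N :=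
  AddMonoidHom.mk' (fun x => envLift f ((bt f N).comp (N.rmul.flip x)) (by
      intro i b _ j a _ k c _
      change bt f N (x <• (b * f a)) c = bt f N (x <• b) (f a * c)
      rw [← bt_smul, op_smul_op_smul])) (by
    intro x y
    ext t
    refine envelope_ext ?_ t
    intro i b _ c
    change bt f N ((x + y) <• b) c = bt f N (x <• b) c + bt f N (y <• b) c
    rw [smul_add, map_add, AddMonoidHom.add_apply])

lemma envToBaseChange_envTmul (x : N) (b c : B) :
    envToBaseChange f N x (envTmul f b c) = bt f N (x <• b) c := rfl

lemma envToBaseChange_inl_mul (x : N) (b : B) (t : envelope f) :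
    envToBaseChange f N x (inl f b * t) = envToBaseChange f N (x <• b) t := by
  refine envelope_ext (g := (envToBaseChange f N x).comp (AddMonoidHom.mulLeft (inl f b)))
    (h := envToBaseChange f N (x <• b)) ?_ t
  intro i c _ e
  change envToBaseChange f N x (inl f b * envTmul f c e) = _
  rw [inl_mul_envTmul, envToBaseChange_envTmul, envToBaseChange_envTmul, op_smul_op_smul]

lemma envToBaseChange_mul_inr (x : N) (t : envelope f) (c : B) :
    envToBaseChange f N x (t * inr f c) = envToBaseChange f N x t <• c := by
  refine envelope_ext (g := (envToBaseChange f N x).comp (AddMonoidHom.mulRight (inr f c)))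
    (h := ((baseChange f N).rmul c).comp (envToBaseChange f N x)) ?_ t
  intro i b _ e
  change envToBaseChange f N x (envTmul f b e * inr f c) = _
  rw [envTmul_mul_inr]
  rfl

lemma envToBaseChange_mem {i j k : ℤ} (h : i + j = k) {x : N} (hx : x ∈ N.gr i) {t : envelope f}
    (ht : t ∈ (envelope f).gr j) : envToBaseChange f N x t ∈ (baseChange f N).gr k := by
  refine map_mem_of_envTmul ?_ ht
  intro p q h' b hb c hc
  exact bt_mem (by omega) (N.smul_mem' hx hb) hc

lemma envToBaseChange_d {i : ℤ} {x : N} (hx : x ∈ N.gr i) (t : envelope f) :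
    (baseChange f N).d (envToBaseChange f N x t)
      = envToBaseChange f N (N.d x) t + sgn i • envToBaseChange f N x ((envelope f).d t) := by
  refine envelope_ext (g := (baseChange f N).d.comp (envToBaseChange f N x))
    (h := envToBaseChange f N (N.d x)
      + sgn i • (envToBaseChange f N x).comp (envelope f).d.toAddMonoidHom) ?_ t
  intro j b hb c
  simp only [AddMonoidHom.comp_apply, AddMonoidHom.add_apply, AddMonoidHom.smul_apply,
    LinearMap.toAddMonoidHom_coe]
  rw [envTmul_d hb, map_add, map_zsmul, envToBaseChange_envTmul, envToBaseChange_envTmul,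
    envToBaseChange_envTmul, envToBaseChange_envTmul, bt_d (N.smul_mem' hx hb),
    N.leibniz i x hx, map_add, map_zsmul,
    AddMonoidHom.add_apply, AddMonoidHom.smul_apply, smul_add, smul_smul, sgn_add, add_assoc]

lemma piHom_envToBaseChange (x : N) (t : envelope f) :
    piHom f N (envToBaseChange f N x t) = x <• mult f t := by
  refine envelope_ext (g := (piHom f N).toLinearMap.toAddMonoidHom.comp (envToBaseChange f N x))
    (h := (N.rmul.flip x).comp ((mult f).toAlgHom : envelope f →+ B)) ?_ t
  intro i b _ c
  change (x <• b) <• c = x <• (b * c)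
  exact op_smul_op_smul x b c

variable (f N) in
/-- The map `N ⊗_B J → N ⊗_A B`, `x ⊗ (b ⊗ c) ↦ x b ⊗ c`, that identifies `N ⊗_B J` with the kernel
of `π_N`. -/
def diagToBaseChange : tens f N (diag f) →+ baseChange f N :=
  tlift (inl f) ((envToBaseChange f N).compl₂ (diagVal f)) (by
    intro i x _ j b _ k y _
    simp only [AddMonoidHom.compl₂_apply]
    rw [diagVal_lsmul, envToBaseChange_inl_mul])

lemma diagToBaseChange_tm (x : N) (y : diag f) :
    diagToBaseChange f N (tm f N (diag f) x y) = envToBaseChange f N x (diagVal f y) := rfl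

lemma diagToBaseChange_delta (x : N) (b : B) :
    diagToBaseChange f N (tm f N (diag f) x (deltaHom f b)) = bt f N (x <• b) 1 - bt f N x b := by
  rw [diagToBaseChange_tm, diagVal_delta, map_sub]
  change bt f N (x <• b) 1 - bt f N (x <• (1 : B)) b = _
  rw [MulOpposite.op_one, one_smul]

lemma diagToBaseChange_rsmul (t : tens f N (diag f)) (c : B) :
    diagToBaseChange f N (t <• inr f c) = diagToBaseChange f N t <• c := by
  refine tens_ext (g := (diagToBaseChange f N).comp ((tens f N (diag f)).rmul (inr f c)))
    (h := ((baseChange f N).rmul c).comp (diagToBaseChange f N)) ?_ t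
  intro i x _ j y _
  exact envToBaseChange_mul_inr x (diagVal f y) c

lemma diagToBaseChange_mem {k : ℤ} {t : tens f N (diag f)} (ht : t ∈ (tens f N (diag f)).gr k) :
    diagToBaseChange f N t ∈ (baseChange f N).gr k :=
  map_mem_of_tm (fun _ _ h _ hx _ hy => envToBaseChange_mem h hx hy) ht

lemma diagToBaseChange_d (t : tens f N (diag f)) :
    diagToBaseChange f N ((tens f N (diag f)).d t)
      = (baseChange f N).d (diagToBaseChange f N t) := by
  refine tens_ext (g := (diagToBaseChange f N).comp (tens f N (diag f)).d)
    (h := (baseChange f N).d.comp (diagToBaseChange f N)) ?_ t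
  intro i x hx j y _
  simp only [AddMonoidHom.comp_apply]
  rw [tens_d hx, map_add, map_zsmul, diagToBaseChange_tm, diagToBaseChange_tm,
    diagToBaseChange_tm, envToBaseChange_d hx]
  rfl

lemma piHom_diagToBaseChange (t : tens f N (diag f)) :
    piHom f N (diagToBaseChange f N t) = 0 := by
  refine tens_ext (g := (piHom f N).toLinearMap.toAddMonoidHom.comp (diagToBaseChange f N))
    (h := 0) ?_ t
  intro i x _ j y _
  have hy : mult f (diagVal f y) = 0 := y.2
  refine (piHom_envToBaseChange x (diagVal f y)).trans ?_
  rw [hy]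
  simp

lemma delta_mul (a : A) (b : B) :
    deltaHom f (f a * b) = (diag f).lsmul (inl f (f a)) (deltaHom f b) := by
  apply diagVal_injective
  rw [diagVal_lsmul, diagVal_delta, diagVal_delta, map_mul, map_mul, ← inl_eq_inr, mul_sub]

variable (f N) in
/-- The map `N ⊗_A B → N ⊗_B J`, `x ⊗ b ↦ - x ⊗ δ b`. It comes from the retraction `t ↦ t - μ(t) ⊗ 1`
of `J → B ⊗_A B`, where `μ` is the multiplication, and is in general not `B`-linear. -/
def baseChangeToDiag : baseChange f N →+ tens f N (diag f) :=
  tlift (N := DGMod.restrict f N) (X := DGMod.self B) f (-(tm f N (diag f)).compl₂ (deltaHom f)) (by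
    intro i (x : N) _ j a _ k (b : B) _
    have h : tm f N (diag f) (x <• f a) (deltaHom f b)
        = tm f N (diag f) x (deltaHom f ((DGMod.self B).lsmul (f a) b)) := by
      rw [tm_smul, ← delta_mul]
      exact congrArg (fun c => tm f N (diag f) x (deltaHom f c)) (DGMod.self_lsmul B (f a) b).symm
    exact congrArg Neg.neg h)

lemma baseChangeToDiag_bt (x : N) (b : B) :
    baseChangeToDiag f N (bt f N x b) = -tm f N (diag f) x (deltaHom f b) := rfl

lemma baseChangeToDiag_mem {k : ℤ} {t : baseChange f N} (ht : t ∈ (baseChange f N).gr k) :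
    baseChangeToDiag f N t ∈ (tens f N (diag f)).gr k := by
  refine map_mem_of_bt ?_ ht
  intro i j h x hx b hb
  rw [baseChangeToDiag_bt]
  refine neg_mem (tm_mem h hx ?_)
  have := (isDerivation_deltaHom f).mem j b hb
  rwa [add_zero] at this

variable (f) in
/-- The map `B ⊗_A B → J`, `t ↦ t - μ(t) ⊗ 1`, where `μ` is the multiplication: a retraction of the
inclusion of `J` that is `B`-linear on the left. -/
def diagRetraction : envelope f →+ diag f :=
  AddMonoidHom.mk' (fun t => diagMk f (t - inl f (mult f t)) (by
    have h : mult f (inl f (mult f t)) = mult f t := mul_one (mult f t)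
    rw [map_sub, h, sub_self])) (by
    intro s t
    apply diagVal_injective
    rw [map_add (diagVal f), diagVal_mk, diagVal_mk, diagVal_mk]
    simp only [map_add]
    abel)

lemma diagVal_retraction (t : envelope f) :
    diagVal f (diagRetraction f t) = t - inl f (mult f t) := rfl

lemma diagRetraction_val (y : diag f) : diagRetraction f (diagVal f y) = y := by
  have hy : mult f (diagVal f y) = 0 := y.2
  apply diagVal_injective
  rw [diagVal_retraction, hy, map_zero, sub_zero]

lemma baseChangeToDiag_envToBaseChange (x : N) (t : envelope f) :
    baseChangeToDiag f N (envToBaseChange f N x t) = tm f N (diag f) x (diagRetraction f t) := by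
  refine envelope_ext (g := (baseChangeToDiag f N).comp (envToBaseChange f N x))
    (h := (tm f N (diag f) x).comp (diagRetraction f)) ?_ t
  intro i b _ c
  rw [AddMonoidHom.comp_apply, AddMonoidHom.comp_apply, envToBaseChange_envTmul,
    baseChangeToDiag_bt, tm_smul, ← map_neg]
  congr 1
  apply diagVal_injective
  rw [map_neg, diagVal_lsmul, diagVal_delta, diagVal_retraction, mult_envTmul, map_mul,
    inr_eq_envTmul, mul_sub, inl_mul_envTmul, mul_one, neg_sub]

lemma baseChangeToDiag_diagToBaseChange (t : tens f N (diag f)) :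
    baseChangeToDiag f N (diagToBaseChange f N t) = t := by
  refine tens_ext (g := (baseChangeToDiag f N).comp (diagToBaseChange f N))
    (h := AddMonoidHom.id _) ?_ t
  intro i x _ j y _
  rw [AddMonoidHom.comp_apply, diagToBaseChange_tm, baseChangeToDiag_envToBaseChange,
    diagRetraction_val]
  rfl

lemma diagToBaseChange_injective : Function.Injective (diagToBaseChange f N) :=
  Function.LeftInverse.injective baseChangeToDiag_diagToBaseChange

lemma diagToBaseChange_baseChangeToDiag (t : baseChange f N) :
    diagToBaseChange f N (baseChangeToDiag f N t) = t - bt f N (piHom f N t) 1 := by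
  refine baseChange_ext (g := (diagToBaseChange f N).comp (baseChangeToDiag f N))
    (h := AddMonoidHom.id _
      - ((bt f N).flip 1).comp (piHom f N).toLinearMap.toAddMonoidHom) ?_ t
  intro i x _ b
  rw [AddMonoidHom.comp_apply, baseChangeToDiag_bt, map_neg, diagToBaseChange_delta, neg_sub]
  rfl

lemma bt_one_d (x : N) : (baseChange f N).d (bt f N x 1) = bt f N (N.d x) 1 := by
  refine N.ext_homog (f := (baseChange f N).d.comp ((bt f N).flip 1))
    (g := ((bt f N).flip 1).comp N.d) ?_ x
  intro i x hx
  simp only [AddMonoidHom.comp_apply, AddMonoidHom.flip_apply]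
  rw [bt_d hx, B.d_one, map_zero, smul_zero, add_zero]

/-- A DG section `s` of `π_N` corresponds to the `δ`-connection `x ↦ x ⊗ 1 - s x`, which has values in
the kernel `N ⊗_B J` of `π_N`. -/
lemma naivelyLiftable_iff_exists_cycle :
    NaivelyLiftable f N ↔ ∃ ψ : N →+ tens f N (diag f),
      IsConnection f N (diag f) 0 (deltaHom f) ψ ∧ homD (tens f N (diag f)) N.d 0 ψ = 0 := by
  constructor
  · rintro ⟨s, hs⟩
    let σ : N →+ baseChange f N := s.toLinearMap.toAddMonoidHom
    have hσr : ∀ x (b : B), σ (x <• b) = σ x <• b := fun x b => s.map_smul' (MulOpposite.op b) x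
    have hσd : ∀ x, σ (N.d x) = (baseChange f N).d (σ x) := s.map_d
    -- As `δ 1 = 0`, this is `x ↦ x ⊗ 1 - s x` seen in `N ⊗_B J`.
    let ψ : N →+ tens f N (diag f) := -(baseChangeToDiag f N).comp σ
    have hψ : ∀ x, diagToBaseChange f N (ψ x) = bt f N x 1 - σ x := by
      intro x
      have h1 := diagToBaseChange_baseChangeToDiag (σ x)
      have h2 : piHom f N (σ x) = x := hs x
      rw [h2] at h1
      change diagToBaseChange f N (-baseChangeToDiag f N (σ x)) = _
      rw [map_neg, h1, neg_sub]
    refine ⟨ψ, ⟨?_, ?_, ?_⟩, ?_⟩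
    · intro i x hx
      rw [add_zero]
      exact neg_mem (baseChangeToDiag_mem (s.map_mem i x hx))
    · intro x a
      apply diagToBaseChange_injective
      rw [diagToBaseChange_rsmul, hψ, hψ, hσr, smul_sub, bt_rsmul, bt_smul, one_mul, mul_one]
    · intro i x _ b
      apply diagToBaseChange_injective
      rw [map_add, zero_mul, sgn_zero, one_smul, diagToBaseChange_rsmul, diagToBaseChange_delta,
        hψ, hψ, hσr, smul_sub, bt_rsmul, one_mul]
      abel
    · ext x
      rw [homD_apply, sgn_zero, one_smul, AddMonoidHom.zero_apply, sub_eq_zero]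
      apply diagToBaseChange_injective
      rw [diagToBaseChange_d, hψ, hψ, map_sub, hσd, bt_one_d]
  · rintro ⟨ψ, hψ, hψd⟩
    let σ : N →+ baseChange f N := (bt f N).flip 1 - (diagToBaseChange f N).comp ψ
    have hσ : ∀ x, σ x = bt f N x 1 - diagToBaseChange f N (ψ x) := fun _ => rfl
    have hσr : ∀ x (b : B), σ (x <• b) = σ x <• b := by
      intro x b
      refine N.ext_homog (f := σ.comp (N.rmul b)) (g := ((baseChange f N).rmul b).comp σ) ?_ x
      intro i x hx
      simp only [AddMonoidHom.comp_apply, GrMod.rmul_apply]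
      rw [hσ, hσ, hψ.rule i x hx, map_add, zero_mul, sgn_zero, one_smul, diagToBaseChange_rsmul,
        diagToBaseChange_delta, smul_sub, bt_rsmul, one_mul]
      abel
    have hσd : ∀ x, σ (N.d x) = (baseChange f N).d (σ x) := by
      intro x
      have := DFunLike.congr_fun hψd x
      rw [homD_apply, sgn_zero, one_smul, AddMonoidHom.zero_apply, sub_eq_zero] at this
      rw [hσ, hσ, map_sub, bt_one_d, ← diagToBaseChange_d, this]
    refine ⟨{ toFun := σ, map_add' := map_add σ, map_smul' := fun c x => hσr x c.unop,
              map_mem := ?_, map_d := hσd }, ?_⟩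
    · intro i x hx
      have := hψ.mem i x hx
      rw [add_zero] at this
      exact sub_mem (bt_mem (add_zero i) hx B.one_mem) (diagToBaseChange_mem this)
    · intro x
      change piHom f N (bt f N x 1 - diagToBaseChange f N (ψ x)) = x
      refine (map_sub (piHom f N).toLinearMap _ _).trans ?_
      refine (congrArg₂ (· - ·) (piHom_bt x 1) (piHom_diagToBaseChange (ψ x))).trans ?_
      simp

end Lifting

/-! ### Splittings -/

section Splitting

variable {f N} {X : DGMod (envelope f)}

/-- The components of a section of `ν`, as maps into pairs. -/
def sectionPair (s : LeftDGHom (derMod f X) (connMod f N X)) (n : ℤ) :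
    derGroup f X n →+ (B →+ X) × (N →+ tens f N X) :=
  (connGroup f N X n).subtype.comp (s.app n)

/-- For a section `s` of `ν`, the homomorphism `ψ - s D` attached to a `D`-connection `ψ`. -/
def connRetraction (s : LeftDGHom (derMod f X) (connMod f N X))
    (hs : ∀ n (D : (derMod f X).comp n), (nu f N X).app n (s.app n D) = D) (n : ℤ) :
    connGroup f N X n →+ homGroup f N X n where
  toFun p := ⟨p.1.2 - (sectionPair s n ((nu f N X).app n p)).2, by
    have h := ((connGroup f N X n).sub_mem p.2 (s.app n ((nu f N X).app n p)).2).2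
    have e : (p.1 - (s.app n ((nu f N X).app n p)).1).1 = 0 :=
      sub_eq_zero.2 (congrArg Subtype.val (hs n ((nu f N X).app n p))).symm
    rw [e] at h
    exact isHom_iff.2 h⟩
  map_zero' := by
    refine Subtype.ext ?_
    have e : (nu f N X).app n (0 : connGroup f N X n) = 0 := map_zero _
    dsimp only
    rw [e]
    have e' : sectionPair s n 0 = 0 := map_zero _
    refine (congrArg (fun q => (0 : N →+ tens f N X) - q.2) e').trans ?_
    exact sub_zero 0
  map_add' p q := by
    refine Subtype.ext ?_
    have e : sectionPair s n ((nu f N X).app n (p + q)) = sectionPair s n ((nu f N X).app n p)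
        + sectionPair s n ((nu f N X).app n q) :=
      (congrArg (sectionPair s n) (map_add ((nu f N X).app n) p q)).trans (map_add _ _ _)
    refine (congrArg (fun z => (p.1.2 + q.1.2) - z.2) e).trans ?_
    exact add_sub_add_comm _ _ _ _

/-- A section `s` of `ν` splits the sequence, with retraction `ψ ↦ ψ - s (ν ψ)`. -/
lemma fundamentalSplits_iff : FundamentalSplits f N X ↔ AdmitsDerConnection f N X := by
  refine ⟨fun ⟨_, s, _, hs, _⟩ => ⟨s, hs⟩, fun ⟨s, hs⟩ => ?_⟩
  refine ⟨⟨connRetraction s hs, ?_, ?_⟩, s, ?_, hs, ?_⟩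
  · rintro i j _ rfl b p
    have e : sectionPair s (i + j) ((derMod f X).smul rfl b ((nu f N X).app j p))
        = connAct f N X b (sectionPair s j ((nu f N X).app j p)) :=
      congrArg Subtype.val (s.map_smul rfl b ((nu f N X).app j p))
    refine Subtype.ext ?_
    refine (congrArg (fun z => bAct f (tens f N X) b p.1.2 - z.2) e).trans ?_
    exact (map_sub (bAct f (tens f N X) b) _ _).symm
  · intro n p
    have e : sectionPair s (n - 1) ((derMod f X).d n ((nu f N X).app n p))
        = connD f N X n (sectionPair s n ((nu f N X).app n p)) :=
      congrArg Subtype.val (s.map_d n ((nu f N X).app n p))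
    refine Subtype.ext ?_
    refine (congrArg (fun z => homD (tens f N X) N.d n p.1.2 - z.2) e).trans ?_
    exact (map_sub (homD (tens f N X) N.d n) _ _).symm
  · intro n g
    have e : sectionPair s n 0 = 0 := map_zero _
    refine Subtype.ext ?_
    refine (congrArg (fun z => g.1 - z.2) e).trans ?_
    exact sub_zero _
  · intro n p
    refine Subtype.ext (Prod.ext ?_ ?_)
    · exact (zero_add _).trans (congrArg Subtype.val (hs n ((nu f N X).app n p)))
    · exact sub_add_cancel p.1.2 (sectionPair s n ((nu f N X).app n p)).2

end Splitting

end

end NaiveLifting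

theorem mainTheorem1 {R : Type u} [CommRing R] {A B : NaiveLifting.DGAlg R}
    (f : NaiveLifting.DGAlgHom A B)
    (hB : (NaiveLifting.DGMod.restrict f (NaiveLifting.DGMod.self B)).toGrMod.IsProjective)
    (N : NaiveLifting.DGMod B) (hN : N.IsSemifree) :
    List.TFAE [
      NaiveLifting.NaivelyLiftable f N,
      ∃ ψ : (NaiveLifting.connMod f N (NaiveLifting.diag f)).comp 0,
        (NaiveLifting.nu f N (NaiveLifting.diag f)).app 0 ψ = NaiveLifting.delta f ∧
          (NaiveLifting.connMod f N (NaiveLifting.diag f)).d 0 ψ = 0,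
      NaiveLifting.FundamentalSplits f N (NaiveLifting.diag f),
      ∀ X : NaiveLifting.DGMod (NaiveLifting.envelope f), NaiveLifting.FundamentalSplits f N X,
      NaiveLifting.AdmitsDerConnection f N (NaiveLifting.diag f),
      ∀ X : NaiveLifting.DGMod (NaiveLifting.envelope f),
        NaiveLifting.AdmitsDerConnection f N X] := by
  open NaiveLifting in
  simp only [fundamentalSplits_iff]
  tfae_have 1 → 2 := by
    intro h
    obtain ⟨ψ, hψ, hd⟩ := naivelyLiftable_iff_exists_cycle.1 h
    exact ⟨⟨(deltaHom f, ψ), isDerivation_deltaHom f, hψ⟩, rfl,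
      Subtype.ext (Prod.ext homD_deltaHom hd)⟩
  tfae_have 2 → 1 := by
    rintro ⟨⟨⟨D, ψ⟩, hD, hψ⟩, h, hd⟩
    obtain rfl : D = deltaHom f := congrArg Subtype.val h
    exact naivelyLiftable_iff_exists_cycle.2
      ⟨ψ, hψ, congrArg (fun p => p.1.2) hd⟩
  tfae_have 1 → 4 := by
    intro h
    obtain ⟨ψ, hψ, hd⟩ := naivelyLiftable_iff_exists_cycle.1 h
    exact admitsDerConnection_of_cycle hψ hd
  tfae_have 4 → 3 := fun h => h _
  tfae_have 3 ↔ 5 := Iff.rfl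
  tfae_have 4 ↔ 6 := Iff.rfl
  tfae_have 5 → 2 := by
    rintro ⟨s, hs⟩
    refine ⟨s.app 0 (delta f), hs 0 _, ?_⟩
    have h0 : (derMod f (diag f)).d 0 (delta f) = 0 := Subtype.ext homD_deltaHom
    rw [← s.map_d, h0, map_zero]
  tfae_finish
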